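/- Let $k$ be a field, $A$ an associative unital $k$-algebra and $M=\{M_1,\dots,M_r\}$ a family of $r$ simple right $A$-modules. For $1\le i,j\le r$ let $C^\bullet(A,\mathrm{Hom}_k(M_i,M_j))$ be the Hochschild complex: $C^0=\mathrm{Hom}_k(M_i,M_j)$, $C^1$ and $C^2$ consist of the $k$-linear, respectively $k$-bilinear, maps from $A$, respectively $A\times A$, to $\mathrm{Hom}_k(M_i,M_j)$, $$(d\varphi)(a)(m)=\varphi(ma)-\varphi(m)a,\qquad (d\psi)(a,b)(m)=\psi(b)(ma)-\psi(ab)(m)+\psi(a)(m)b ,$$ so that $H^1=\mathrm{Ext}^1_A(M_i,M_j)$, and for $\psi\in C^1$ of type $(i,j)$ and $\varphi\in C^1$ of type $(j,m)$ let $(\psi\cup\varphi)(a,b)=\varphi(b)\circ\psi(a)$. Assume that $l_{ij}=\dim_k\mathrm{Ext}^1_A(M_i,M_j)$ is finite for all $i,j$, and let $X=\{x_{ij}(p):1\le p\le l_{ij}\}$ be $1$-cocycles whose classes form a basis of $\mathrm{Ext}^1_A(M_i,M_j)$ for all $i,j$. The formal algebra $\hat H(M)=\hat A(X\subset C^1,C^2,\cup,d)$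 is computed as follows. Let $k\langle X\rangle$ be the free $r\times r$ matrix polynomial algebra on $X$, whose basis consists of the composable words in the $x_{ij}(p)$ together with the idempotents $e_1,\dots,e_r$, let $\mathfrak m$ be the ideal generated by the $x_{ij}(p)$, and let $\{y_q\}$ be a basis of $C^2/\mathrm{im}\,d$, chosen in each type $(i,j)$. Put $v_{x_{ij}(p)}=x_{ij}(p)$. Suppose that for $1\le n<N$ there have been chosen finite sets $B_n$ of monomials of degree $n$, and elements $v_u\in C^1$ for $u\in B_n$. Put $$f_q^N=\sum_{s,t\in B_1\cup\dots\cup B_{N-1}}y_q^\ast(v_s\cup v_t)\,st,\qquad \overline H_N=k\langle X\rangle/\bigl((f_q^N)_q+\mathfrak m^{N+1}\bigr).$$ Choose for $B_N$ a set of monomials of degree $N$ whose classes form a basis of $\ker(\overline H_N\to\overline H_{N-1})$, so that $\{e_1,\dots,e_r\}\cup B_1\cup\dots\cup B_N$ gives a basis of $\overline H_N$, and, if $N\ge2$, choose for every $u\in B_N$ an element $v_u\in C^1$ with $$d(v_u)=-\sum_{s,t\in B_1\cup\dots\cup B_{N-1}}\beta_{st,u}\,v_s\cup v_t ,$$ where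 $\beta_{st,u}$ is the coefficient of $u$ in the expression of $st$ in the basis of $\overline H_N$. Finally $\hat H(M)=\varprojlim_N\overline H_N$. Put $\hat A_M=\mathrm{End}_k\bigl(\hat H(M)\otimes_{k^r}\bigoplus_{i=1}^rM_i\bigr)$, let $\rho_i:A\to\mathrm{End}_k(M_i)$, $\rho_i(a)(m)=ma$, be the structure morphisms, and let the diagonal map $\delta:\hat A_M\to\bigoplus_{i=1}^r\mathrm{End}_k(M_i)$ send $F$ to the maps $M_i\to M_i$ obtained by composing $m\mapsto 1\otimes m$, $F$, the map induced by the augmentation $\hat H(M)\to k^r$, and the projection to $M_i$. Endomorphisms of right modules are composed from left to right. Then, for every basis $\{y_q\}$, these choices can be made at all stages, and for every outcome $\hat H(M)$ there exists a homomorphism of $k$-algebras $\iota:A\to\hat A_M$ such that $$\delta\circ\iota=\bigoplus_{i=1}^r\rho_i ,$$ and such that every $\iota(a)$ is $\hat H(M)$-linear. Moreover, if all $M_i$ are finite dimensional over $k$, $\iota$ can be chosen so that, in addition, for all $a\in A$, all $i$ and all $m\in M_i$, the image of $\iota(a)(1\otimes m)$ in $\overline H_1\otimes_{k^r}\bigoplus_jM_j$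 is $$1\otimes ma+\sum_{j=1}^r\sum_{p=1}^{l_{ij}}x_{ij}(p)\otimes x_{ij}(p)(a)(m).$$ -/

import Mathlib

open scoped TensorProduct

noncomputable section

namespace GMMP

universe u v w

/-! ## Matrix polynomial algebras -/

/-- The monomials of type `(i, j)` in variables `x_{ij}(p)`, `p < l i j`: the composable words
`x_{i i₁}(p₁) x_{i₁ i₂}(p₂) ⋯ x_{iₙ j}(pₙ₊₁)`, including the empty word (the idempotent `e_i`)
when `i = j`. -/
inductive Monomial {r : ℕ} (l : Fin r → Fin r → ℕ) : Fin r → Fin r → Type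
  | one (i : Fin r) : Monomial l i i
  | cons {i j m : Fin r} (p : Fin (l i j)) (u : Monomial l j m) : Monomial l i m

namespace Monomial

variable {r : ℕ} {l : Fin r → Fin r → ℕ}

/-- The variable `x_{ij}(p)` as a monomial. -/
def var {i j : Fin r} (p : Fin (l i j)) : Monomial l i j := cons p (one j)

/-- The length of a word. -/
def degree : {i j : Fin r} → Monomial l i j → ℕ
  | _, _, one _ => 0
  | _, _, cons _ u => u.degree + 1

/-- Concatenation of words. -/
def mul : {i j m : Fin r} → Monomial l i j → Monomial l j m → Monomial l i m
  | _, _, _, one _, t => t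
  | _, _, _, cons p u, t => cons p (u.mul t)

@[simp] theorem one_mul {i j : Fin r} (t : Monomial l i j) : (one i).mul t = t := rfl

@[simp] theorem mul_one {i j : Fin r} (s : Monomial l i j) : s.mul (one j) = s := by
  induction s with
  | one i => rfl
  | cons p u ih => simp [mul, ih]

theorem mul_assoc {i j m n : Fin r} (s : Monomial l i j) (t : Monomial l j m)
    (q : Monomial l m n) : (s.mul t).mul q = s.mul (t.mul q) := by
  induction s with
  | one i => rfl
  | cons p u ih => simp [mul, ih]

@[simp] theorem degree_one (i : Fin r) : (one i : Monomial l i i).degree = 0 := rfl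

@[simp] theorem degree_mul {i j m : Fin r} (s : Monomial l i j) (t : Monomial l j m) :
    (s.mul t).degree = s.degree + t.degree := by
  induction s with
  | one i => simp [mul]
  | cons p u ih => simp [mul, degree, ih]; omega

end Monomial

section MatPoly

variable (k : Type u) [Field k] {r : ℕ} (l : Fin r → Fin r → ℕ)

/-- The free `r × r` matrix polynomial algebra `⊕ₙ T^n_{k^r}(V)`, where `V_{ij}` has basis
`x_{ij}(p)`, `p < l i j`: the `(i, j)` entry of an element is a linear combination of monomials
of type `(i, j)`. -/
def MatPoly : Type u := ∀ i j : Fin r, Monomial l i j →₀ k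

instance : AddCommGroup (MatPoly k l) :=
  inferInstanceAs (AddCommGroup (∀ i j : Fin r, Monomial l i j →₀ k))

instance : Module k (MatPoly k l) :=
  inferInstanceAs (Module k (∀ i j : Fin r, Monomial l i j →₀ k))

variable {l}

/-- The bilinear extension of concatenation. -/
def conv (i j m : Fin r) :
    (Monomial l i j →₀ k) →ₗ[k] (Monomial l j m →₀ k) →ₗ[k] (Monomial l i m →₀ k) :=
  Finsupp.linearCombination k fun s => Finsupp.lmapDomain k k (fun t => s.mul t)

@[simp] theorem conv_single (i j m : Fin r) (s : Monomial l i j) (t : Monomial l j m) (a b : k) :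
    conv k i j m (Finsupp.single s a) (Finsupp.single t b) = Finsupp.single (s.mul t) (a * b) := by
  simp [conv, Finsupp.linearCombination_single, Finsupp.mapDomain_single]

theorem conv_assoc (i j m n : Fin r) (f : Monomial l i j →₀ k) (g : Monomial l j m →₀ k)
    (h : Monomial l m n →₀ k) :
    conv k i m n (conv k i j m f g) h = conv k i j n f (conv k j m n g h) := by
  induction f using Finsupp.induction_linear with
  | zero => simp
  | add f f' hf hf' => simp [hf, hf']
  | single s a =>
    induction g using Finsupp.induction_linear with
    | zero => simp
    | add g g' hg hg' => simp [hg, hg']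
    | single t b =>
      induction h using Finsupp.induction_linear with
      | zero => simp
      | add h h' hh hh' => rw [map_add, map_add, map_add, hh, hh']
      | single q c => simp only [conv_single, Monomial.mul_assoc, mul_assoc]

theorem conv_one_left (i j : Fin r) (g : Monomial l i j →₀ k) :
    conv k i i j (Finsupp.single (Monomial.one i) 1) g = g := by
  induction g using Finsupp.induction_linear with
  | zero => simp
  | add g g' hg hg' => simp [hg, hg']
  | single t b => simp

theorem conv_one_right (i j : Fin r) (g : Monomial l i j →₀ k) :
    conv k i j j g (Finsupp.single (Monomial.one j) 1) = g := by
  induction g using Finsupp.induction_linear with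
  | zero => simp
  | add g g' hg hg' => simp [hg, hg']
  | single t b => simp

namespace MatPoly

variable {k}

/-- A single monomial, as a matrix with one nonzero entry. -/
def mono {i j : Fin r} (s : Monomial l i j) : MatPoly k l :=
  Pi.single i (Pi.single j (Finsupp.single s 1))

/-- The diagonal matrix `∑ cᵢ eᵢ`. -/
def diag (c : Fin r → k) : MatPoly k l :=
  fun i => Pi.single i (Finsupp.single (Monomial.one i) (c i))

/-- Matrix multiplication, entries being multiplied by concatenation of words. -/
instance : Mul (MatPoly k l) := ⟨fun f g i m => ∑ j, conv k i j m (f i j) (g j m)⟩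

instance : One (MatPoly k l) := ⟨diag fun _ => 1⟩

theorem mul_apply (f g : MatPoly k l) (i m : Fin r) :
    (f * g) i m = ∑ j, conv k i j m (f i j) (g j m) := rfl

theorem add_apply (f g : MatPoly k l) (i m : Fin r) : (f + g) i m = f i m + g i m := rfl

theorem smul_apply (c : k) (f : MatPoly k l) (i m : Fin r) : (c • f) i m = c • f i m := rfl

theorem zero_apply (i m : Fin r) : (0 : MatPoly k l) i m = 0 := rfl

theorem one_eq : (1 : MatPoly k l) = diag fun _ => 1 := rfl

theorem diag_apply_same (c : Fin r → k) (i : Fin r) :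
    (diag c : MatPoly k l) i i = Finsupp.single (Monomial.one i) (c i) := by
  simp [diag]

theorem diag_apply_ne (c : Fin r → k) {i j : Fin r} (h : i ≠ j) :
    (diag c : MatPoly k l) i j = 0 := by
  simp [diag, Pi.single_eq_of_ne h.symm]

theorem ext' {f g : MatPoly k l} (h : ∀ i j, f i j = g i j) : f = g :=
  funext fun i => funext fun j => h i j

instance : Ring (MatPoly k l) :=
  { (inferInstance : AddCommGroup (MatPoly k l)),
    (inferInstance : Mul (MatPoly k l)),
    (inferInstance : One (MatPoly k l)) with
    left_distrib := fun f g h => ext' fun i j => by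
      simp [mul_apply, add_apply, Finset.sum_add_distrib]
    right_distrib := fun f g h => ext' fun i j => by
      simp [mul_apply, add_apply, Finset.sum_add_distrib]
    zero_mul := fun f => ext' fun i j => by simp [mul_apply, zero_apply]
    mul_zero := fun f => ext' fun i j => by simp [mul_apply, zero_apply]
    mul_assoc := fun f g h => ext' fun i j => by
      simp only [mul_apply, map_sum, LinearMap.sum_apply, conv_assoc]
      rw [Finset.sum_comm]
    one_mul := fun f => ext' fun i j => by
      rw [mul_apply, Finset.sum_eq_single i]
      · rw [one_eq, diag_apply_same, conv_one_left]
      · intro b _ hb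
        rw [one_eq, diag_apply_ne _ hb.symm]; simp
      · simp
    mul_one := fun f => ext' fun i j => by
      rw [mul_apply, Finset.sum_eq_single j]
      · rw [one_eq, diag_apply_same, conv_one_right]
      · intro b _ hb
        rw [one_eq, diag_apply_ne _ hb]; simp
      · simp }

instance : Algebra k (MatPoly k l) :=
  Algebra.ofModule
    (fun c f g => ext' fun i j => by simp [mul_apply, smul_apply, Finset.smul_sum])
    (fun c f g => ext' fun i j => by simp [mul_apply, smul_apply, Finset.smul_sum])

/-- The structure map `k^r → k⟨N⟩`. -/
def diagHom : (Fin r → k) →+* MatPoly k l where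
  toFun := diag
  map_one' := rfl
  map_zero' := ext' fun i j => by
    by_cases h : i = j
    · subst h; simp [diag_apply_same, zero_apply]
    · simp [diag_apply_ne _ h, zero_apply]
  map_add' c c' := ext' fun i j => by
    by_cases h : i = j
    · subst h; simp [diag_apply_same, add_apply]
    · simp [diag_apply_ne _ h, add_apply]
  map_mul' c c' := ext' fun i j => by
    rw [mul_apply, Finset.sum_eq_single i]
    · by_cases h : i = j
      · subst h; simp [diag_apply_same]
      · simp [diag_apply_ne _ h]
    · intro b _ hb
      rw [diag_apply_ne _ hb.symm]; simp
    · simp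

/-- The coefficient of the empty word is multiplicative. -/
theorem conv_apply_one (i : Fin r) (f g : MatPoly k l) :
    (f * g) i i (Monomial.one i) = f i i (Monomial.one i) * g i i (Monomial.one i) := by
  classical
  have key : ∀ (j : Fin r) (a : Monomial l i j →₀ k) (b : Monomial l j i →₀ k),
      j ≠ i → conv k i j i a b (Monomial.one i) = 0 := by
    intro j a b hj
    induction a using Finsupp.induction_linear with
    | zero => simp
    | add a a' ha ha' => simp [ha, ha']
    | single s c =>
      induction b using Finsupp.induction_linear with
      | zero => simp
      | add b b' hb hb' => simp [hb, hb']
      | single t c' =>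
        rw [conv_single, Finsupp.single_apply, if_neg]
        intro h
        cases s with
        | one => exact hj rfl
        | cons p u => simp [Monomial.mul] at h
  have key' : ∀ (a b : Monomial l i i →₀ k),
      conv k i i i a b (Monomial.one i) = a (Monomial.one i) * b (Monomial.one i) := by
    intro a b
    induction a using Finsupp.induction_linear with
    | zero => simp
    | add a a' ha ha' => simp [ha, ha', add_mul]
    | single s c =>
      induction b using Finsupp.induction_linear with
      | zero => simp
      | add b b' hb hb' => simp [hb, hb', mul_add]
      | single t c' =>
        rw [conv_single]
        cases s with
        | one =>
          by_cases ht : t = Monomial.one i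
          · subst ht; simp
          · simp [ht]
        | cons p u => simp [Finsupp.single_apply, Monomial.mul]
  rw [mul_apply, Finsupp.finsetSum_apply, Finset.sum_eq_single i]
  · exact key' _ _
  · intro j _ hj
    exact key j _ _ hj
  · simp

/-- The augmentation `k⟨N⟩ → k^r` sending every variable to `0`. -/
def aug : MatPoly k l →+* (Fin r → k) where
  toFun f i := f i i (Monomial.one i)
  map_one' := by
    funext i
    rw [one_eq, diag_apply_same]; simp
  map_zero' := rfl
  map_add' _ _ := rfl
  map_mul' f g := funext fun i => conv_apply_one i f g

theorem aug_mono {i j : Fin r} (s : Monomial l i j) (hs : 0 < s.degree) :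
    aug (mono s : MatPoly k l) = 0 := by
  classical
  funext m
  change (mono s : MatPoly k l) m m (Monomial.one m) = 0
  unfold mono
  by_cases hi : m = i
  · subst hi
    by_cases hj : m = j
    · subst hj
      rw [Pi.single_eq_same, Pi.single_eq_same, Finsupp.single_apply, if_neg]
      rintro rfl
      simp at hs
    · rw [Pi.single_eq_same, Pi.single_eq_of_ne hj]; rfl
  · rw [Pi.single_eq_of_ne hi]; rfl

theorem aug_smul (c : k) (f : MatPoly k l) : aug (c • f) = c • aug f := rfl

theorem aug_diag (c : Fin r → k) : aug (diagHom c : MatPoly k l) = c := by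
  funext i
  change (diag c : MatPoly k l) i i (Monomial.one i) = c i
  rw [diag_apply_same]; simp

end MatPoly

end MatPoly

/-! ## GMMP-algebras and the formal algebra of a GMMP-algebra -/

/-- A GMMP-algebra `(V, W, ∪, d)` in `r × r` matrix form: `V = (V_{ij})`, `W = (W_{ij})` are
matrices of vector spaces, `∪ : V ⊗_{k^r} V → W` and `d : V → W` are linear and respect the
indices. -/
structure GMMPAlgebra (k : Type u) [Field k] (r : ℕ) where
  V : Fin r → Fin r → Type v
  W : Fin r → Fin r → Type w
  [addCommGroupV : ∀ i j, AddCommGroup (V i j)]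
  [moduleV : ∀ i j, Module k (V i j)]
  [addCommGroupW : ∀ i j, AddCommGroup (W i j)]
  [moduleW : ∀ i j, Module k (W i j)]
  cup : ∀ i j m, V i j →ₗ[k] V j m →ₗ[k] W i m
  d : ∀ i j, V i j →ₗ[k] W i j

attribute [instance] GMMPAlgebra.addCommGroupV GMMPAlgebra.moduleV
  GMMPAlgebra.addCommGroupW GMMPAlgebra.moduleW

/-- The data chosen during the computation of the formal algebra: for every `n ≥ 1` a finite set
`B n` of monomials of degree `n`, and for every monomial `u` in one of these sets an element
`v_u` of `V` (the value of `v` at other monomials is never used). -/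
structure Choices {k : Type u} [Field k] {r : ℕ} (L : GMMPAlgebra.{u, v, w} k r)
    (l : Fin r → Fin r → ℕ) where
  B : ℕ → ∀ i j, Finset (Monomial l i j)
  v : ∀ {i j}, Monomial l i j → L.V i j
  degree_eq : ∀ n i j, ∀ s ∈ B n i j, s.degree = n

section Algorithm

variable {k : Type u} [Field k] {r : ℕ} {L : GMMPAlgebra.{u, v, w} k r}
  {l : Fin r → Fin r → ℕ} {I : Fin r → Fin r → Type*}
  (y : ∀ i j, Module.Basis (I i j) k (L.W i j ⧸ LinearMap.range (L.d i j)))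

namespace Choices

variable (c : Choices L l)

/-- The polynomial `f_q^N` attached to the basis element `y_q` of `W_{ij} / im d`: the coefficient
of `y_q` in `∑ (v_s ∪ v_t) ⊗ s t`, summed over the chosen monomials `s`, `t` of positive degree
less than `N`. -/
def rel (N : ℕ) (i j : Fin r) (q : I i j) : MatPoly k l :=
  ∑ a ∈ Finset.Ico 1 N, ∑ b ∈ Finset.Ico 1 N, ∑ m : Fin r, ∑ s ∈ c.B a i m, ∑ t ∈ c.B b m j,
    (y i j).coord q (Submodule.Quotient.mk (L.cup i m j (c.v s) (c.v t))) •
      MatPoly.mono (s.mul t)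

/-- The two-sided ideal `(f_q^N) + 𝔪^{N+1}` of the matrix polynomial algebra. -/
def relIdeal (N : ℕ) : TwoSidedIdeal (MatPoly k l) :=
  TwoSidedIdeal.span
    ({f | ∃ (i j : Fin r) (q : I i j), f = c.rel y N i j q} ∪
      {f | ∃ (i j : Fin r) (s : Monomial l i j), N < s.degree ∧ f = MatPoly.mono s})

theorem mono_mem_relIdeal (N : ℕ) {i j : Fin r} (s : Monomial l i j) (hs : N < s.degree) :
    (MatPoly.mono s : MatPoly k l) ∈ c.relIdeal y N :=
  TwoSidedIdeal.subset_span (Or.inr ⟨i, j, s, hs, rfl⟩)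

/-- The stage `N` algebra `H̄_N = k⟨X⟩ / ((f_q^N) + 𝔪^{N+1})`. -/
def HBar (N : ℕ) : Type u := MatPoly k l ⧸ (c.relIdeal y N).asIdeal

instance (N : ℕ) : Ring (c.HBar y N) :=
  inferInstanceAs (Ring (MatPoly k l ⧸ (c.relIdeal y N).asIdeal))

instance (N : ℕ) : Algebra k (c.HBar y N) :=
  inferInstanceAs (Algebra k (MatPoly k l ⧸ (c.relIdeal y N).asIdeal))

/-- The quotient map onto `H̄_N`. -/
def quot (N : ℕ) : MatPoly k l →ₐ[k] c.HBar y N :=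
  Ideal.Quotient.mkₐ k (c.relIdeal y N).asIdeal

theorem quot_surjective (N : ℕ) : Function.Surjective (c.quot y N) :=
  Ideal.Quotient.mkₐ_surjective k _

theorem quot_eq_zero (N : ℕ) (f : MatPoly k l) : c.quot y N f = 0 ↔ f ∈ c.relIdeal y N :=
  Ideal.Quotient.eq_zero_iff_mem.trans TwoSidedIdeal.mem_asIdeal

theorem quot_rel_succ (N : ℕ) (i j : Fin r) (q : I i j) :
    c.quot y N (c.rel y (N + 1) i j q) = c.quot y N (c.rel y N i j q) := by
  have hz : ∀ a b, 1 ≤ a → 1 ≤ b → (N ≤ a ∨ N ≤ b) →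
      c.quot y N (∑ m : Fin r, ∑ s ∈ c.B a i m, ∑ t ∈ c.B b m j,
        (y i j).coord q (Submodule.Quotient.mk (L.cup i m j (c.v s) (c.v t))) •
          MatPoly.mono (s.mul t)) = 0 := by
    intro a b ha hb hab
    simp only [map_sum, map_smul]
    refine Finset.sum_eq_zero fun m _ => Finset.sum_eq_zero fun s hs =>
      Finset.sum_eq_zero fun t ht => ?_
    have h1 := c.degree_eq _ _ _ _ hs
    have h2 := c.degree_eq _ _ _ _ ht
    rw [(c.quot_eq_zero y N _).2, smul_zero]
    exact c.mono_mem_relIdeal y N _ (by rw [Monomial.degree_mul]; omega)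
  rcases Nat.eq_zero_or_pos N with rfl | hN
  · simp [rel]
  · unfold rel
    rw [map_sum, map_sum, Finset.sum_Ico_succ_top hN, map_sum,
      Finset.sum_eq_zero (s := Finset.Ico 1 (N + 1)), add_zero]
    · refine Finset.sum_congr rfl fun a ha => ?_
      rw [Finset.sum_Ico_succ_top hN, map_add, hz a N (Finset.mem_Ico.1 ha).1 hN (Or.inr le_rfl),
        add_zero]
    · intro b hb
      exact hz N b hN (Finset.mem_Ico.1 hb).1 (Or.inl le_rfl)

theorem relIdeal_succ_le (N : ℕ) : c.relIdeal y (N + 1) ≤ c.relIdeal y N := by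
  refine TwoSidedIdeal.span_le.2 ?_
  rintro f (⟨i, j, q, rfl⟩ | ⟨i, j, s, hs, rfl⟩)
  · refine (c.quot_eq_zero y N _).1 ?_
    rw [quot_rel_succ, quot_eq_zero]
    exact TwoSidedIdeal.subset_span (Or.inl ⟨i, j, q, rfl⟩)
  · exact c.mono_mem_relIdeal y N s (by omega)

/-- The projection `π : H̄_{N+1} → H̄_N`. -/
def trans (N : ℕ) : c.HBar y (N + 1) →ₐ[k] c.HBar y N :=
  Ideal.Quotient.liftₐ (c.relIdeal y (N + 1)).asIdeal (c.quot y N) fun f hf =>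
    (c.quot_eq_zero y N f).2 (c.relIdeal_succ_le y N (TwoSidedIdeal.mem_asIdeal.1 hf))

@[simp] theorem trans_quot (N : ℕ) (f : MatPoly k l) :
    c.trans y N (c.quot y (N + 1) f) = c.quot y N f := rfl

/-- The inverse limit of the algebras `H̄_N`. -/
def limit : Subalgebra k (∀ N, c.HBar y N) where
  carrier := {h | ∀ N, c.trans y N (h (N + 1)) = h N}
  mul_mem' {a b} ha hb N := by simp [ha N, hb N]
  add_mem' {a b} ha hb N := by simp [ha N, hb N]
  algebraMap_mem' a N := by simp

/-- `Ĥ = lim H̄_N`. -/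
def HHat : Type u := c.limit y

instance : Ring (c.HHat y) := inferInstanceAs (Ring (c.limit y))

instance : Algebra k (c.HHat y) := inferInstanceAs (Algebra k (c.limit y))

/-- The projection `Ĥ → H̄_N`. -/
def proj (N : ℕ) : c.HHat y →ₐ[k] c.HBar y N :=
  (Pi.evalAlgHom k (fun N => c.HBar y N) N).comp (c.limit y).val

/-- The completion map from the matrix polynomial algebra to `Ĥ`. -/
def toHHat : MatPoly k l →ₐ[k] c.HHat y :=
  AlgHom.codRestrict (AlgHom.pi fun N => c.quot y N) (c.limit y)
    fun _ _ => rfl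

@[simp] theorem proj_toHHat (N : ℕ) (f : MatPoly k l) :
    c.proj y N (c.toHHat y f) = c.quot y N f := rfl

/-- `k^r` acts on `H̄_N` by multiplication from the right, through `k^r → H̄_N`. -/
instance (N : ℕ) : Module (Fin r → k) (c.HBar y N) where
  smul a h := h * c.quot y N (MatPoly.diagHom a)
  one_smul h := by change h * _ = h; simp
  mul_smul a b h := by
    change h * _ = h * _ * _
    rw [mul_comm a b, map_mul, map_mul, mul_assoc]
  smul_zero a := by change 0 * _ = _; simp
  smul_add a g h := by change (g + h) * _ = g * _ + h * _; rw [add_mul]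
  add_smul a b h := by change h * _ = h * _ + h * _; rw [map_add, map_add, mul_add]
  zero_smul h := by change h * _ = 0; simp

/-- `k^r` acts on `Ĥ` by multiplication from the right, through `k^r → Ĥ`. -/
instance : Module (Fin r → k) (c.HHat y) where
  smul a h := h * c.toHHat y (MatPoly.diagHom a)
  one_smul h := by change h * _ = h; simp
  mul_smul a b h := by
    change h * _ = h * _ * _
    rw [mul_comm a b, map_mul, map_mul, mul_assoc]
  smul_zero a := by change 0 * _ = _; simp
  smul_add a g h := by change (g + h) * _ = g * _ + h * _; rw [add_mul]
  add_smul a b h := by change h * _ = h * _ + h * _; rw [map_add, map_add, mul_add]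
  zero_smul h := by change h * _ = 0; simp

theorem smul_HBar_def (N : ℕ) (a : Fin r → k) (h : c.HBar y N) :
    a • h = h * c.quot y N (MatPoly.diagHom a) := rfl

theorem smul_HHat_def (a : Fin r → k) (h : c.HHat y) :
    a • h = h * c.toHHat y (MatPoly.diagHom a) := rfl

instance : SMulCommClass (Fin r → k) k (c.HHat y) :=
  ⟨fun a b h => by rw [smul_HHat_def, smul_HHat_def, smul_mul_assoc]⟩

instance : SMulCommClass (Fin r → k) (c.HHat y) (c.HHat y) :=
  ⟨fun a g h => by
    rw [smul_HHat_def, smul_HHat_def, smul_eq_mul, smul_eq_mul, mul_assoc]⟩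

theorem relIdeal_zero_le_ker : c.relIdeal y 0 ≤ TwoSidedIdeal.ker (MatPoly.aug (k := k) (l := l)) := by
  refine TwoSidedIdeal.span_le.2 ?_
  rintro f (⟨i, j, q, rfl⟩ | ⟨i, j, s, hs, rfl⟩)
  · simp [rel]
  · exact (TwoSidedIdeal.mem_ker _).2 (MatPoly.aug_mono s hs)

/-- The augmentation `H̄_0 → k^r`. -/
def augBar : c.HBar y 0 →+* (Fin r → k) :=
  Ideal.Quotient.lift (c.relIdeal y 0).asIdeal MatPoly.aug fun _ hf =>
    (TwoSidedIdeal.mem_ker _).1 (c.relIdeal_zero_le_ker y (TwoSidedIdeal.mem_asIdeal.1 hf))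

/-- The augmentation `Ĥ → k^r`. -/
def augHat : c.HHat y →ₗ[Fin r → k] (Fin r → k) where
  toFun h := c.augBar y (c.proj y 0 h)
  map_add' g h := by simp
  map_smul' a h := by
    rw [smul_HHat_def, map_mul, map_mul, proj_toHHat]
    change _ * MatPoly.aug (MatPoly.diagHom a) = _
    rw [MatPoly.aug_diag, RingHom.id_apply, smul_eq_mul, mul_comm]

theorem augHat_smul (a : k) (h : c.HHat y) : c.augHat y (a • h) = a • c.augHat y h := by
  change c.augBar y (c.proj y 0 (a • h)) = a • c.augBar y (c.proj y 0 h)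
  rw [map_smul]
  obtain ⟨f, hf⟩ := c.quot_surjective y 0 (c.proj y 0 h)
  rw [← hf, ← map_smul]
  exact MatPoly.aug_smul (k := k) (l := l) a f

theorem const_smul_HHat (a : k) (h : c.HHat y) : (fun _ => a : Fin r → k) • h = a • h := by
  have h1 : (MatPoly.diagHom (fun _ => a) : MatPoly k l) = a • 1 := MatPoly.ext' fun i j => by
    change (MatPoly.diag (fun _ => a) : MatPoly k l) i j =
      a • (MatPoly.diag (fun _ => 1) : MatPoly k l) i j
    by_cases hij : i = j
    · subst hij; simp [MatPoly.diag_apply_same]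
    · simp [MatPoly.diag_apply_ne _ hij]
  rw [smul_HHat_def, h1, map_smul, map_one, mul_smul_comm, mul_one]

/-- The projection `Ĥ → H̄_N`, as a map of right `k^r`-modules. -/
def projLin (N : ℕ) : c.HHat y →ₗ[Fin r → k] c.HBar y N where
  toFun h := c.proj y N h
  map_add' g h := map_add _ g h
  map_smul' a h := by
    rw [smul_HHat_def, map_mul, proj_toHHat, RingHom.id_apply, smul_HBar_def]

end Choices

/-- A run of the algorithm that computes the formal algebra `Â(X ⊂ V, W, ∪, d)`, for
`X = {x_{ij}(p)}` and the basis `y` of `W / im d`. Besides the empty words `e_i`, the monomials in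
`B 1, …, B N` form the monomial basis of `H̄_N`. -/
structure Computation (x : ∀ i j, Fin (l i j) → L.V i j)
    (y : ∀ i j, Module.Basis (I i j) k (L.W i j ⧸ LinearMap.range (L.d i j)))
    extends Choices L l where
  /-- `v_u = x_{ij}(p)` for the monomial `u = x_{ij}(p)`. -/
  v_var : ∀ (i j : Fin r) (p : Fin (l i j)), v (Monomial.var p) = x i j p
  /-- `B (N + 1)` is a monomial basis of the kernel of `H̄_{N+1} → H̄_N`. -/
  linearIndependent : ∀ N, LinearIndependent k
    fun s : (Σ i j, {s : Monomial l i j // s ∈ B (N + 1) i j}) =>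
      toChoices.quot y (N + 1) (MatPoly.mono s.2.2.1)
  span_eq : ∀ N, Submodule.span k (Set.range
    fun s : (Σ i j, {s : Monomial l i j // s ∈ B (N + 1) i j}) =>
      toChoices.quot y (N + 1) (MatPoly.mono s.2.2.1)) =
        LinearMap.ker (toChoices.trans y N).toLinearMap
  /-- `β N s u` is the coefficient of `u` in the expression of `s` in the monomial basis of
  `H̄_N`. -/
  β : ℕ → ∀ {i j}, Monomial l i j → Monomial l i j → k
  quot_eq_sum : ∀ (N : ℕ) (i j : Fin r) (s : Monomial l i j), 0 < s.degree →
    toChoices.quot y N (MatPoly.mono s) =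
      ∑ n ∈ Finset.Ico 1 (N + 1), ∑ u ∈ B n i j, β N s u • toChoices.quot y N (MatPoly.mono u)
  /-- For `u ∈ B N`, `N ≥ 2`, the element `v_u` solves `d v_u = -∑ β_{st,u} v_s ∪ v_t`. -/
  d_v : ∀ N, 2 ≤ N → ∀ (i j : Fin r), ∀ u ∈ B N i j,
    L.d i j (v u) = -∑ a ∈ Finset.Ico 1 N, ∑ b ∈ Finset.Ico 1 N, ∑ m : Fin r,
      ∑ s ∈ B a i m, ∑ t ∈ B b m j, β N (s.mul t) u • L.cup i m j (v s) (v t)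

end Algorithm

/-! ## The GMMP-algebra of a family of right modules -/

section Cohomology

variable (k : Type u) [Field k] {C : Type v} [AddCommGroup C] [Module k C]

/-- The quotient `Z / (B ∩ Z)` of cocycles `Z` by coboundaries `B` (here always `B ⊆ Z`). -/
def Cohomology (Z B : Submodule k C) : Type v := Z ⧸ B.submoduleOf Z

instance (Z B : Submodule k C) : AddCommGroup (Cohomology k Z B) :=
  inferInstanceAs (AddCommGroup (Z ⧸ B.submoduleOf Z))

instance (Z B : Submodule k C) : Module k (Cohomology k Z B) :=
  inferInstanceAs (Module k (Z ⧸ B.submoduleOf Z))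

/-- The class of a cocycle. -/
def Cohomology.mk (Z B : Submodule k C) : Z →ₗ[k] Cohomology k Z B :=
  (B.submoduleOf Z).mkQ

end Cohomology

section Hochschild

variable (k : Type u) [Field k] (A : Type v) [Ring A] [Algebra k A] {r : ℕ}
  (M : Fin r → Type w) [∀ i, AddCommGroup (M i)] [∀ i, Module k (M i)]
  [∀ i, Module Aᵐᵒᵖ (M i)] [∀ i, IsScalarTower k Aᵐᵒᵖ (M i)]

/-- The structure morphism `ρ_i : a ↦ (m ↦ m a)` of the right module `M_i`. It is an algebra
homomorphism into the algebra of endomorphisms composed from left to right. -/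
def rho (i : Fin r) : A →ₐ[k] (Module.End k (M i))ᵐᵒᵖ :=
  AlgHom.opComm.symm (Algebra.lsmul k k (M i))

theorem rho_apply (i : Fin r) (a : A) (m : M i) :
    (rho k A M i a).unop m = MulOpposite.op a • m := rfl

/-- Right multiplication by `a`, linearly in `a`. -/
def act (i : Fin r) : A →ₗ[k] Module.End k (M i) :=
  (MulOpposite.opLinearEquiv k).symm.toLinearMap ∘ₗ (rho k A M i).toLinearMap

@[simp] theorem act_apply (i : Fin r) (a : A) (m : M i) :
    act k A M i a m = MulOpposite.op a • m := rfl

/-- Hochschild `1`-cochains with values in the bimodule `Hom_k(M_i, M_j)`. -/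
abbrev C1 (i j : Fin r) := A →ₗ[k] (M i →ₗ[k] M j)

/-- Hochschild `2`-cochains with values in the bimodule `Hom_k(M_i, M_j)`. -/
abbrev C2 (i j : Fin r) := A →ₗ[k] A →ₗ[k] (M i →ₗ[k] M j)

/-- The product `(ψ ∪ φ)(a, b) = φ(b) ∘ ψ(a)`. -/
def cup (i j m : Fin r) : C1 k A M i j →ₗ[k] C1 k A M j m →ₗ[k] C2 k A M i m :=
  LinearMap.mk₂ k
    (fun ψ φ => LinearMap.mk₂ k (fun a b => φ b ∘ₗ ψ a)
      (fun a a' b => by simp [LinearMap.comp_add]) (fun c a b => by simp [LinearMap.comp_smul])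
      (fun a b b' => by simp [LinearMap.add_comp]) (fun c a b => by simp [LinearMap.smul_comp]))
    (fun ψ ψ' φ => by ext; simp) (fun c ψ φ => by ext; simp)
    (fun ψ φ φ' => by ext; simp) (fun c ψ φ => by ext; simp)

@[simp] theorem cup_apply (i j m : Fin r) (ψ : C1 k A M i j) (φ : C1 k A M j m) (a b : A)
    (z : M i) : cup k A M i j m ψ φ a b z = φ b (ψ a z) := rfl

/-- The Hochschild differential `(d⁰ φ)(a) = a φ - φ a`, that is `m ↦ φ(m a) - φ(m) a`. -/
def d0 (i j : Fin r) : (M i →ₗ[k] M j) →ₗ[k] C1 k A M i j :=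
  LinearMap.mk₂ k (fun φ a => φ ∘ₗ act k A M i a - act k A M j a ∘ₗ φ)
    (fun φ φ' a => by ext; simp; abel) (fun c φ a => by ext; simp [smul_sub])
    (fun φ a a' => by ext; simp; abel) (fun c φ a => by ext; simp [smul_sub])

/-- The Hochschild differential `(d¹ ψ)(a, b) = a ψ(b) - ψ(a b) + ψ(a) b`, that is
`m ↦ ψ(b)(m a) - ψ(a b)(m) + ψ(a)(m) b`. -/
def d1 (i j : Fin r) : C1 k A M i j →ₗ[k] C2 k A M i j :=
  LinearMap.mk₂ k (fun ψ a =>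
      (LinearMap.lcomp k (M j) (act k A M i a)) ∘ₗ ψ - ψ ∘ₗ LinearMap.mulLeft k a
        + ((LinearMap.llcomp k (M i) (M j) (M j)).flip (ψ a)) ∘ₗ act k A M j)
    (fun ψ ψ' a => by ext; simp; abel) (fun c ψ a => by ext; simp [smul_sub])
    (fun ψ a a' => by ext; simp [add_mul]; abel)
    (fun c ψ a => by ext; simp [smul_sub])

@[simp] theorem d0_apply (i j : Fin r) (φ : M i →ₗ[k] M j) (a : A) (z : M i) :
    d0 k A M i j φ a z = φ (MulOpposite.op a • z) - MulOpposite.op a • φ z := rfl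

@[simp] theorem d1_apply (i j : Fin r) (ψ : C1 k A M i j) (a b : A) (z : M i) :
    d1 k A M i j ψ a b z =
      ψ b (MulOpposite.op a • z) - ψ (a * b) z + MulOpposite.op b • ψ a z := rfl

theorem d1_d0 (i j : Fin r) (φ : M i →ₗ[k] M j) : d1 k A M i j (d0 k A M i j φ) = 0 := by
  ext a b z
  simp only [d1_apply, d0_apply, MulOpposite.op_mul, mul_smul, smul_sub, LinearMap.zero_apply]
  abel

/-- The space of `1`-cocycles. -/
abbrev Z1 (i j : Fin r) : Submodule k (C1 k A M i j) := LinearMap.ker (d1 k A M i j)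

/-- `Ext¹_A(M_i, M_j)` as the first Hochschild cohomology of `Hom_k(M_i, M_j)`. -/
abbrev Ext1 (i j : Fin r) := Cohomology k (Z1 k A M i j) (LinearMap.range (d0 k A M i j))

/-- The class of a `1`-cocycle in `Ext¹_A(M_i, M_j)`. -/
def extClass (i j : Fin r) : Z1 k A M i j →ₗ[k] Ext1 k A M i j :=
  Cohomology.mk k (Z1 k A M i j) (LinearMap.range (d0 k A M i j))

/-- The GMMP-algebra `(C¹(A, M), C²(A, M), ∪, d)`. -/
def hochschildGMMP : GMMPAlgebra.{u, max v w, max v w} k r where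
  V := C1 k A M
  W := C2 k A M
  cup := cup k A M
  d := d1 k A M

end Hochschild

/-! ## The completion -/

section Completion

variable {k : Type u} [Field k] {r : ℕ} {L : GMMPAlgebra.{u, v, w} k r}
  {l : Fin r → Fin r → ℕ} {I : Fin r → Fin r → Type*}
  (y : ∀ i j, Module.Basis (I i j) k (L.W i j ⧸ LinearMap.range (L.d i j)))
  (c : Choices L l)
  (M : Fin r → Type*) [∀ i, AddCommGroup (M i)] [∀ i, Module k (M i)]

/-- `Ĥ ⊗_{k^r} (⊕ M_i)`, where `k^r` acts on `⊕ M_i` componentwise. -/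
abbrev HatTensor := c.HHat y ⊗[Fin r → k] (∀ i, M i)

/-- The completion `Â_M = End_k(Ĥ ⊗_{k^r} (⊕ M_i))`, with endomorphisms composed from left to right
(they act from the right, as `A` does on `M_i`). -/
abbrev Completion := (Module.End k (HatTensor y c M))ᵐᵒᵖ

/-- The map `Ĥ ⊗_{k^r} (⊕ M_i) → k^r ⊗_{k^r} (⊕ M_i) = ⊕ M_i` induced by the augmentation
`Ĥ → k^r`. -/
def reduce : HatTensor y c M →ₗ[k] (∀ i, M i) where
  toFun z := TensorProduct.lid (Fin r → k) (∀ i, M i) ((c.augHat y).rTensor (∀ i, M i) z)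
  map_add' z z' := by simp
  map_smul' a z := by
    induction z using TensorProduct.induction_on with
    | zero => simp
    | add z z' hz hz' => simp only [smul_add, map_add, hz, hz']
    | tmul h m =>
      rw [TensorProduct.smul_tmul']
      simp only [LinearMap.rTensor_tmul, TensorProduct.lid_tmul, c.augHat_smul, RingHom.id_apply,
        smul_assoc]

/-- The diagonal map `δ : End_k(Ĥ ⊗_{k^r} (⊕ M_i)) → ⊕ End_k(M_i)`: its `i`-th component sends
`F` to the composite of `M_i → Ĥ ⊗_{k^r} (⊕ M_i)`, `m ↦ 1 ⊗ m`, with `F` and with the reduction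
to `M_i`. -/
def diagonal (F : Completion y c M) (i : Fin r) : (Module.End k (M i))ᵐᵒᵖ :=
  MulOpposite.op
    { toFun := fun m => reduce y c M (F.unop (1 ⊗ₜ[Fin r → k] Pi.single i m)) i
      map_add' := fun m m' => by
        rw [Pi.single_add, TensorProduct.tmul_add, map_add, map_add, Pi.add_apply]
      map_smul' := fun a m => by
        have h : (1 : c.HHat y) ⊗ₜ[Fin r → k] (Pi.single i (a • m) : ∀ i, M i) =
            a • ((1 : c.HHat y) ⊗ₜ[Fin r → k] (Pi.single i m : ∀ i, M i)) := by
          have h1 : (Pi.single i (a • m) : ∀ i, M i) =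
              (fun _ => a : Fin r → k) • (Pi.single i m : ∀ i, M i) := by
            rw [Pi.single_smul]; rfl
          rw [h1, ← TensorProduct.smul_tmul, c.const_smul_HHat, TensorProduct.smul_tmul']
        rw [h, map_smul, map_smul, Pi.smul_apply, RingHom.id_apply] }

/-- The reduction `Ĥ ⊗_{k^r} (⊕ M_i) → H̄_N ⊗_{k^r} (⊕ M_i)`. -/
def reduceBar (N : ℕ) : HatTensor y c M →ₗ[Fin r → k] c.HBar y N ⊗[Fin r → k] (∀ i, M i) :=
  (c.projLin y N).rTensor (∀ i, M i)

end Completion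

end GMMP

end

/-! Existence of the choices. The relations of stages `N` and `N + 1` differ only by words of degree
at least `N + 1` (`relIdeal_le_sup`), so the kernel of H̄_{N+1} → H̄_N is spanned by words of degree
`N + 1`. These are finite in number, and a maximal independent set of them serves as B_{N+1}. By
induction the chosen words form a basis of the positive-degree part, which gives the coefficients β.
The equation for `v_u` is solvable because f_q vanishes in the quotient: in the basis of chosen
words its coefficient at `u` is y_q^*(∑ β_{st,u} v_s ∪ v_t). This is zero for every `q`, so the
obstruction lies in im d (`sum_cup_mem_range`). The ideal of stage `N + 1` depends only on the data
of degree at most `N`, so the stages can be carried out in succession and glued.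

The homomorphism. For any outcome, the coefficients β are compatible as `N` grows, and the equations
for the `d v_u` combine into the Maurer-Cartan equation ∑ st ⊗ (v_s ∪ v_t) = -∑ u ⊗ d v_u
(`maurerCartan`). Let `a` act by m ↦ 1 ⊗ ma + ∑ u ⊗ v_u(a)(m), extended Ĥ-linearly. The
Maurer-Cartan equation is what makes this action multiplicative (`extend_versal`); it is unital
because v_u(1) = 0, by induction on the degree. The augmentation kills all words of positive degree,
and H̄_1 retains only the variables, whose cochains are the given cocycles.

The infinite sum makes sense in the uncompleted tensor product when each M_j has a finite basis:
collecting the coefficients of each basis vector leaves finitely many pure tensors. Otherwise only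
the diagonal condition and Ĥ-linearity are demanded, and the constant family h ⊗ m ↦ h ⊗ ma
satisfies both. -/

noncomputable section

namespace GMMP

universe u v w

/-! ### Words of a given degree -/

namespace Monomial

variable {r : ℕ} {l : Fin r → Fin r → ℕ}

theorem finite_setOf_degree_eq (n : ℕ) (i j : Fin r) :
    {s : Monomial l i j | s.degree = n}.Finite := by
  induction n generalizing i with
  | zero =>
    refine Set.Subsingleton.finite ?_
    rintro s hs t ht
    cases s with
    | one => cases t with
      | one => rfl
      | cons p u => simp [degree] at ht
    | cons p u => simp [degree] at hs
  | succ n ih =>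
    refine (Set.finite_iUnion fun m : Fin r => Set.finite_iUnion fun p : Fin (l i m) =>
      (ih m).image (cons p)).subset ?_
    rintro s hs
    cases s with
    | one => simp at hs
    | cons p u =>
      simp only [Set.mem_iUnion]
      exact ⟨_, p, u, by simpa [degree] using hs, rfl⟩

theorem exists_eq_var_of_degree_eq_one {i j : Fin r} (s : Monomial l i j) (hs : s.degree = 1) :
    ∃ p, s = var p := by
  cases s with
  | one => simp at hs
  | cons p u => cases u with
    | one => exact ⟨p, rfl⟩
    | cons q u => simp [degree] at hs

@[simp] theorem degree_var {i j : Fin r} (p : Fin (l i j)) : (var p).degree = 1 := rfl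

theorem var_injective {i j : Fin r} :
    Function.Injective (var : Fin (l i j) → Monomial l i j) := by
  intro p q h
  simpa [var] using h

end Monomial

/-! ### Matrix entries and the degree filtration of the matrix polynomial algebra -/

section MatPoly

variable {k : Type u} [Field k] {r : ℕ} {l : Fin r → Fin r → ℕ}

/-- Degree is additive under concatenation, so one factor without short words is enough. This makes
`high` absorb multiplication on both sides. -/
theorem conv_apply_eq_zero {n : ℕ} {i j m : Fin r} {f : Monomial l i j →₀ k}
    {g : Monomial l j m →₀ k}
    (h : (∀ s, s.degree < n → f s = 0) ∨ ∀ t, t.degree < n → g t = 0)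
    (q : Monomial l i m) (hq : q.degree < n) : conv k i j m f g q = 0 := by
  classical
  have key : conv k i j m f g =
      f.sum fun s a => g.sum fun t b => Finsupp.single (s.mul t) (a * b) := by
    conv_lhs => rw [← Finsupp.sum_single f, ← Finsupp.sum_single g]
    simp only [Finsupp.sum, map_sum, LinearMap.sum_apply, conv_single]
    exact Finset.sum_comm
  rw [key, Finsupp.sum, Finsupp.finsetSum_apply]
  refine Finset.sum_eq_zero fun s hs => ?_
  rw [Finsupp.sum, Finsupp.finsetSum_apply]
  refine Finset.sum_eq_zero fun t ht => ?_
  rw [Finsupp.single_apply]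
  split_ifs with hst
  · have hd := congrArg Monomial.degree hst
    rw [Monomial.degree_mul] at hd
    rcases h with h | h
    · rw [h s (by omega), zero_mul]
    · rw [h t (by omega), mul_zero]
  · rfl

namespace MatPoly

/-- The matrix whose only nonzero entry is `f`, in position `(i, j)`. -/
def corner (i j : Fin r) : (Monomial l i j →₀ k) →ₗ[k] MatPoly k l where
  toFun f := Pi.single i (Pi.single j f)
  map_add' f g := by rw [Pi.single_add, Pi.single_add]; rfl
  map_smul' a f := by rw [Pi.single_smul, Pi.single_smul]; rfl

theorem mono_eq_corner {i j : Fin r} (s : Monomial l i j) :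
    (mono s : MatPoly k l) = corner i j (Finsupp.single s 1) := rfl

theorem corner_apply_same (i j : Fin r) (f : Monomial l i j →₀ k) : corner i j f i j = f := by
  change (Pi.single i (Pi.single j f) : ∀ i j, Monomial l i j →₀ k) i j = f
  simp

theorem corner_apply_ne_left {i i' : Fin r} (h : i' ≠ i) (j j' : Fin r)
    (f : Monomial l i j →₀ k) : corner i j f i' j' = 0 := by
  change (Pi.single i (Pi.single j f) : ∀ i j, Monomial l i j →₀ k) i' j' = 0
  simp [h]

theorem corner_apply_ne_right {j j' : Fin r} (h : j' ≠ j) (i i' : Fin r)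
    (f : Monomial l i j →₀ k) : corner i j f i' j' = 0 := by
  by_cases hi : i' = i
  · subst hi
    change (Pi.single i' (Pi.single j f) : ∀ i j, Monomial l i j →₀ k) i' j' = 0
    simp [h]
  · exact corner_apply_ne_left hi _ _ f

theorem corner_eq_sum {i j : Fin r} (f : Monomial l i j →₀ k) :
    corner i j f = ∑ s ∈ f.support, f s • (mono s : MatPoly k l) := by
  conv_lhs => rw [← Finsupp.sum_single f]
  simp only [Finsupp.sum, map_sum, mono_eq_corner, ← map_smul, Finsupp.smul_single, smul_eq_mul,
    mul_one]

theorem eq_sum_corner (f : MatPoly k l) : f = ∑ i, ∑ j, corner i j (f i j) := by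
  have hsum : ∀ (g : Fin r → MatPoly k l) (i j : Fin r), (∑ n, g n) i j = ∑ n, g n i j := by
    intro g i j
    have := Finset.sum_apply (M := fun i => ∀ j, Monomial l i j →₀ k) i Finset.univ g
    exact (congrFun this j).trans (Finset.sum_apply j Finset.univ fun n => g n i)
  refine ext' fun i j => ?_
  rw [hsum, Finset.sum_eq_single i, hsum, Finset.sum_eq_single j, corner_apply_same]
  · exact fun j' _ hj' => corner_apply_ne_right hj'.symm _ _ _
  · simp
  · intro i' _ hi'
    rw [hsum]
    exact Finset.sum_eq_zero fun j' _ => corner_apply_ne_left hi'.symm _ _ _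
  · simp

theorem corner_mul_corner {i j m : Fin r} (f : Monomial l i j →₀ k) (g : Monomial l j m →₀ k) :
    corner i j f * corner j m g = corner i m (conv k i j m f g) := by
  refine ext' fun i' m' => ?_
  rw [mul_apply]
  by_cases hi : i' = i
  · subst hi
    rw [Finset.sum_eq_single j]
    · rw [corner_apply_same]
      by_cases hm : m' = m
      · subst hm; rw [corner_apply_same, corner_apply_same]
      · rw [corner_apply_ne_right hm, corner_apply_ne_right hm, map_zero]
    · intro j' _ hj'
      rw [corner_apply_ne_right hj', map_zero, LinearMap.zero_apply]
    · simp
  · rw [corner_apply_ne_left hi]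
    exact Finset.sum_eq_zero fun j' _ => by
      rw [corner_apply_ne_left hi, map_zero, LinearMap.zero_apply]

theorem corner_mul_corner_of_ne {i j j' m : Fin r} (h : j ≠ j') (f : Monomial l i j →₀ k)
    (g : Monomial l j' m →₀ k) : corner i j f * corner j' m g = 0 := by
  refine ext' fun i' m' => ?_
  rw [mul_apply, zero_apply]
  refine Finset.sum_eq_zero fun n _ => ?_
  by_cases hn : n = j
  · subst hn; rw [corner_apply_ne_left h, map_zero]
  · rw [corner_apply_ne_right hn, map_zero, LinearMap.zero_apply]

theorem mono_mul_mono {i j m : Fin r} (s : Monomial l i j) (t : Monomial l j m) :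
    (mono s * mono t : MatPoly k l) = mono (s.mul t) := by
  simp [mono_eq_corner, corner_mul_corner]

/-- Two-sided ideals are therefore closed under passing to a single matrix entry, which allows
everything to be checked type by type. -/
theorem one_mul_mul_one (f : MatPoly k l) (i j : Fin r) :
    mono (Monomial.one i) * f * mono (Monomial.one j) = corner i j (f i j) := by
  conv_lhs => rw [eq_sum_corner f]
  simp only [Finset.mul_sum, Finset.sum_mul, mono_eq_corner]
  rw [Finset.sum_eq_single i, Finset.sum_eq_single j, corner_mul_corner, corner_mul_corner,
    conv_one_left, conv_one_right]
  · intro j' _ hj'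
    rw [corner_mul_corner, corner_mul_corner_of_ne hj']
  · simp
  · intro i' _ hi'
    refine Finset.sum_eq_zero fun j' _ => ?_
    rw [corner_mul_corner_of_ne hi'.symm, zero_mul]
  · simp

theorem diagHom_eq_sum (c : Fin r → k) :
    (diagHom c : MatPoly k l) = ∑ i, c i • mono (Monomial.one i) := by
  change (diag c : MatPoly k l) = _
  rw [eq_sum_corner (diag c)]
  refine Finset.sum_congr rfl fun i _ => ?_
  rw [Finset.sum_eq_single i, diag_apply_same, mono_eq_corner, ← map_smul, Finsupp.smul_single,
    smul_eq_mul, mul_one]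
  · intro j _ hj
    rw [diag_apply_ne _ hj.symm, map_zero]
  · simp

theorem diagHom_mul_mono {i j : Fin r} (s : Monomial l i j) (c : Fin r → k) :
    diagHom c * mono s = c i • (mono s : MatPoly k l) := by
  rw [diagHom_eq_sum, Finset.sum_mul, Finset.sum_eq_single i, smul_mul_assoc, mono_mul_mono,
    Monomial.one_mul]
  · intro m _ hm
    rw [smul_mul_assoc, mono_eq_corner, mono_eq_corner, corner_mul_corner_of_ne hm, smul_zero]
  · simp

/-- The ideal `𝔪ⁿ` of the elements all of whose words have length at least `n`. -/
def high (n : ℕ) : TwoSidedIdeal (MatPoly k l) :=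
  TwoSidedIdeal.mk' {f | ∀ (i j : Fin r) (s : Monomial l i j), s.degree < n → f i j s = 0}
    (fun _ _ _ _ => rfl)
    (fun {f g} hf hg i j s hs => by
      rw [add_apply, Finsupp.add_apply, hf i j s hs, hg i j s hs, add_zero])
    (fun {f} hf i j s hs => by
      change (-(f i j)) s = 0
      rw [Finsupp.neg_apply, hf i j s hs, neg_zero])
    (fun {f g} hg i m s hs => by
      rw [mul_apply, Finsupp.finsetSum_apply]
      exact Finset.sum_eq_zero fun j _ => conv_apply_eq_zero (Or.inr (hg j m)) s hs)
    (fun {f g} hf i m s hs => by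
      rw [mul_apply, Finsupp.finsetSum_apply]
      exact Finset.sum_eq_zero fun j _ => conv_apply_eq_zero (Or.inl (hf i j)) s hs)

theorem mem_high {n : ℕ} {f : MatPoly k l} :
    f ∈ high n ↔ ∀ (i j : Fin r) (s : Monomial l i j), s.degree < n → f i j s = 0 :=
  TwoSidedIdeal.mem_mk' _ _ _ _ _ _ _

theorem mono_mem_high {n : ℕ} {i j : Fin r} (s : Monomial l i j) (hs : n ≤ s.degree) :
    (mono s : MatPoly k l) ∈ high n := by
  classical
  refine mem_high.2 fun i' j' t ht => ?_
  rw [mono_eq_corner]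
  by_cases hi : i' = i
  · subst hi
    by_cases hj : j' = j
    · subst hj
      rw [corner_apply_same, Finsupp.single_apply, if_neg]
      rintro rfl
      omega
    · rw [corner_apply_ne_right hj]; rfl
  · rw [corner_apply_ne_left hi]; rfl

theorem smul_mem {J : TwoSidedIdeal (MatPoly k l)} (a : k) {f : MatPoly k l} (hf : f ∈ J) :
    a • f ∈ J := by
  rw [← one_mul f, ← smul_mul_assoc]
  exact J.mul_mem_left _ _ hf

end MatPoly

end MatPoly

/-! ### The chosen words as a basis of H̄_N, and vanishing of the obstructions -/

namespace Choices

variable {k : Type u} [Field k] {r : ℕ} {L : GMMPAlgebra.{u, v, w} k r}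
  {l : Fin r → Fin r → ℕ} {I : Fin r → Fin r → Type*}
  (y : ∀ i j, Module.Basis (I i j) k (L.W i j ⧸ LinearMap.range (L.d i j)))
  (c : Choices L l)

open Classical in
/-- The chosen words of positive degree less than `N`. -/
def words (N : ℕ) (i j : Fin r) : Finset (Monomial l i j) :=
  (Finset.Ico 1 N).biUnion fun n => c.B n i j

theorem mem_words {N : ℕ} {i j : Fin r} {s : Monomial l i j} :
    s ∈ c.words N i j ↔ 1 ≤ s.degree ∧ s.degree < N ∧ s ∈ c.B s.degree i j := by
  classical
  simp only [words, Finset.mem_biUnion, Finset.mem_Ico]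
  constructor
  · rintro ⟨n, ⟨h1, h2⟩, hs⟩
    obtain rfl := c.degree_eq _ _ _ _ hs
    exact ⟨h1, h2, hs⟩
  · rintro ⟨h1, h2, hs⟩
    exact ⟨_, ⟨h1, h2⟩, hs⟩

theorem sum_words {X : Type*} [AddCommMonoid X] (N : ℕ) {i j : Fin r} (f : Monomial l i j → X) :
    ∑ s ∈ c.words N i j, f s = ∑ n ∈ Finset.Ico 1 N, ∑ s ∈ c.B n i j, f s := by
  classical
  refine Finset.sum_biUnion fun a _ b _ hab => Finset.disjoint_left.2 fun s hs hs' => hab ?_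
  rw [← c.degree_eq _ _ _ _ hs, ← c.degree_eq _ _ _ _ hs']

theorem sum_words_succ {X : Type*} [AddCommMonoid X] (N : ℕ) {i j : Fin r}
    (f : Monomial l i j → X) :
    ∑ s ∈ c.words (N + 2) i j, f s =
      ∑ s ∈ c.words (N + 1) i j, f s + ∑ s ∈ c.B (N + 1) i j, f s := by
  rw [sum_words, sum_words, Finset.sum_Ico_succ_top (by omega)]

theorem words_mono {N N' : ℕ} (h : N ≤ N') (i j : Fin r) : c.words N i j ⊆ c.words N' i j :=
  fun s hs => by
    rw [mem_words] at hs ⊢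
    exact ⟨hs.1, hs.2.1.trans_le h, hs.2.2⟩

/-- The composable pairs of chosen words of positive degree less than `N`. -/
def pairs (N : ℕ) (i j : Fin r) : Finset (Σ m, Monomial l i m × Monomial l m j) :=
  Finset.univ.sigma fun m => c.words N i m ×ˢ c.words N m j

theorem mem_pairs {N : ℕ} {i j : Fin r} {p : Σ m, Monomial l i m × Monomial l m j} :
    p ∈ c.pairs N i j ↔ p.2.1 ∈ c.words N i p.1 ∧ p.2.2 ∈ c.words N p.1 j := by
  simp [pairs]

theorem pairs_mono {N N' : ℕ} (h : N ≤ N') (i j : Fin r) : c.pairs N i j ⊆ c.pairs N' i j :=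
  fun p hp => by
    rw [mem_pairs] at hp ⊢
    exact ⟨c.words_mono h _ _ hp.1, c.words_mono h _ _ hp.2⟩

theorem sum_pairs_eq_sum_words {X : Type*} [AddCommMonoid X] (N : ℕ) {i j : Fin r}
    (f : ∀ m, Monomial l i m → Monomial l m j → X) :
    ∑ p ∈ c.pairs N i j, f p.1 p.2.1 p.2.2 =
      ∑ m, ∑ s ∈ c.words N i m, ∑ t ∈ c.words N m j, f m s t := by
  rw [pairs, Finset.sum_sigma]
  exact Finset.sum_congr rfl fun m _ => Finset.sum_product _ _ _

theorem sum_pairs {X : Type*} [AddCommMonoid X] (N : ℕ) {i j : Fin r}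
    (f : ∀ m, Monomial l i m → Monomial l m j → X) :
    ∑ p ∈ c.pairs N i j, f p.1 p.2.1 p.2.2 =
      ∑ a ∈ Finset.Ico 1 N, ∑ b ∈ Finset.Ico 1 N, ∑ m, ∑ s ∈ c.B a i m, ∑ t ∈ c.B b m j,
        f m s t := by
  rw [sum_pairs_eq_sum_words]
  simp only [sum_words]
  rw [Finset.sum_comm]
  refine Finset.sum_congr rfl fun a _ => ?_
  rw [Finset.sum_comm (s := Finset.Ico 1 N)]
  exact Finset.sum_congr rfl fun m _ => Finset.sum_comm

/-- One of the two words has degree at least `N`, and the other has degree at least 1. -/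
theorem le_degree_mul_of_notMem_pairs {N : ℕ} {i j : Fin r}
    {p : Σ m, Monomial l i m × Monomial l m j} {N' : ℕ} (hp : p ∈ c.pairs N' i j)
    (hp' : p ∉ c.pairs N i j) : N + 1 ≤ (p.2.1.mul p.2.2).degree := by
  rw [mem_pairs, mem_words, mem_words] at hp hp'
  rw [Monomial.degree_mul]
  by_contra h
  exact hp' ⟨⟨hp.1.1, by omega, hp.1.2.2⟩, ⟨hp.2.1, by omega, hp.2.2.2⟩⟩

theorem rel_eq_sum_pairs (N : ℕ) (i j : Fin r) (q : I i j) :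
    c.rel y N i j q = ∑ p ∈ c.pairs N i j,
      (y i j).coord q (Submodule.Quotient.mk (L.cup i p.1 j (c.v p.2.1) (c.v p.2.2))) •
        MatPoly.mono (p.2.1.mul p.2.2) :=
  (c.sum_pairs N fun m s t => (y i j).coord q (Submodule.Quotient.mk
    (L.cup i m j (c.v s) (c.v t))) • (MatPoly.mono (s.mul t) : MatPoly k l)).symm

theorem rel_mem_relIdeal (N : ℕ) (i j : Fin r) (q : I i j) :
    c.rel y N i j q ∈ c.relIdeal y N :=
  TwoSidedIdeal.subset_span (Or.inl ⟨i, j, q, rfl⟩)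

/-- The pairs that enter f_q at stage `N + 1` but not at stage `N` have products of degree at least
`N + 1`. Consequently the kernel of H̄_{N+1} → H̄_N comes from words of degree at least `N + 1`. -/
theorem relIdeal_le_sup (N : ℕ) :
    c.relIdeal y N ≤ c.relIdeal y (N + 1) ⊔ MatPoly.high (N + 1) := by
  classical
  refine TwoSidedIdeal.span_le.2 ?_
  rintro f (⟨i, j, q, rfl⟩ | ⟨i, j, s, hs, rfl⟩)
  · refine TwoSidedIdeal.mem_sup.2 ⟨_, c.rel_mem_relIdeal y (N + 1) i j q,
      c.rel y N i j q - c.rel y (N + 1) i j q, ?_, by abel⟩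
    rw [rel_eq_sum_pairs, rel_eq_sum_pairs, ← Finset.sum_sdiff (c.pairs_mono N.le_succ i j),
      sub_add_cancel_right]
    refine TwoSidedIdeal.neg_mem _ (TwoSidedIdeal.finsetSum_mem _ _ _ fun p hp => ?_)
    rw [Finset.mem_sdiff] at hp
    exact MatPoly.smul_mem _ (MatPoly.mono_mem_high _ (c.le_degree_mul_of_notMem_pairs hp.1 hp.2))
  · exact TwoSidedIdeal.mem_sup_right (MatPoly.mono_mem_high s hs)

theorem relIdeal_antitone : Antitone (c.relIdeal y) :=
  antitone_nat_of_succ_le fun N => c.relIdeal_succ_le y N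

/-- The sum defining f_q at stage 1 is empty, so only long words generate. This keeps the variables
independent in H̄_1. -/
theorem relIdeal_one_le_high : c.relIdeal y 1 ≤ MatPoly.high 2 := by
  refine TwoSidedIdeal.span_le.2 ?_
  rintro f (⟨i, j, q, rfl⟩ | ⟨i, j, s, hs, rfl⟩)
  · simp [rel]
  · exact MatPoly.mono_mem_high s hs

/-- The chosen words of degree `N + 1` are linearly independent in `H̄_{N+1}`, type by type. -/
def Independent (N : ℕ) : Prop :=
  ∀ (i j : Fin r) (b : Monomial l i j → k),
    ∑ s ∈ c.B (N + 1) i j, b s • MatPoly.mono s ∈ c.relIdeal y (N + 1) →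
      ∀ s ∈ c.B (N + 1) i j, b s = 0

/-- The chosen words of degree `N + 1` span the words of degree `N + 1` in `H̄_{N+1}`, type by
type. -/
def Spanning (N : ℕ) : Prop :=
  ∀ (i j : Fin r) (s : Monomial l i j), s.degree = N + 1 → ∃ b : Monomial l i j → k,
    MatPoly.mono s - ∑ u ∈ c.B (N + 1) i j, b u • MatPoly.mono u ∈ c.relIdeal y (N + 1)

variable {y c}

/-- Words of top degree vanish at the preceding stage, so induction kills the lower coefficients;
independence in top degree kills the rest. -/
theorem eq_zero_of_sum_words_mem {N : ℕ} (hN : ∀ n < N, c.Independent y n) {i j : Fin r}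
    (b : Monomial l i j → k)
    (hb : ∑ u ∈ c.words (N + 1) i j, b u • MatPoly.mono u ∈ c.relIdeal y N) :
    ∀ u ∈ c.words (N + 1) i j, b u = 0 := by
  induction N with
  | zero => simp [words]
  | succ N ih =>
    have hlow : ∀ u ∈ c.words (N + 1) i j, b u = 0 := by
      refine ih (fun n hn => hN n (by omega)) ?_
      have h1 := c.relIdeal_succ_le y N hb
      rw [sum_words_succ] at h1
      have h2 : ∑ u ∈ c.B (N + 1) i j, b u • MatPoly.mono u ∈ c.relIdeal y N :=
        TwoSidedIdeal.finsetSum_mem _ _ _ fun u hu => MatPoly.smul_mem _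
          (c.mono_mem_relIdeal y N u (by rw [c.degree_eq _ _ _ _ hu]; omega))
      simpa using TwoSidedIdeal.sub_mem _ h1 h2
    have hhigh : ∀ u ∈ c.B (N + 1) i j, b u = 0 := by
      refine hN N (by omega) i j b ?_
      rwa [sum_words_succ, Finset.sum_eq_zero fun u hu => by rw [hlow u hu, zero_smul],
        zero_add] at hb
    intro u hu
    rw [mem_words] at hu
    by_cases hd : u.degree = N + 1
    · exact hhigh u (hd ▸ hu.2.2)
    · exact hlow u (c.mem_words.2 ⟨hu.1, by omega, hu.2.2⟩)

theorem Spanning.exists_of_mem {N : ℕ} (hN : c.Spanning y N) {i j : Fin r}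
    (f : Monomial l i j →₀ k) (hf : ∀ s, s.degree < N + 1 → f s = 0) :
    ∃ b : Monomial l i j → k, MatPoly.corner i j f -
      ∑ u ∈ c.B (N + 1) i j, b u • MatPoly.mono u ∈ c.relIdeal y (N + 1) := by
  have key : ∀ s : Monomial l i j, ∃ b : Monomial l i j → k, f s • MatPoly.mono s -
      ∑ u ∈ c.B (N + 1) i j, b u • MatPoly.mono u ∈ c.relIdeal y (N + 1) := by
    intro s
    rcases lt_trichotomy s.degree (N + 1) with hs | hs | hs
    · exact ⟨0, by simp [hf s hs]⟩
    · obtain ⟨b, hb⟩ := hN i j s hs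
      refine ⟨fun u => f s * b u, ?_⟩
      have := MatPoly.smul_mem (f s) hb
      simpa [smul_sub, Finset.smul_sum, smul_smul] using this
    · exact ⟨0, by simpa using MatPoly.smul_mem _ (c.mono_mem_relIdeal y _ s hs)⟩
  choose b hb using key
  refine ⟨fun u => ∑ s ∈ f.support, b s u, ?_⟩
  rw [MatPoly.corner_eq_sum]
  simp only [Finset.sum_smul]
  rw [Finset.sum_comm, ← Finset.sum_sub_distrib]
  exact TwoSidedIdeal.finsetSum_mem _ _ _ fun s _ => hb s

/-- This is the spanning half of the description of ker(H̄_{N+1} → H̄_N): by `relIdeal_le_sup` only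
the part of degree at least `N + 1` survives, and degrees beyond `N + 1` are zero. -/
theorem exists_of_mem_relIdeal {N : ℕ} (hN : c.Spanning y N) {f : MatPoly k l}
    (hf : f ∈ c.relIdeal y N) (i j : Fin r) :
    ∃ b : Monomial l i j → k, MatPoly.corner i j (f i j) -
      ∑ u ∈ c.B (N + 1) i j, b u • MatPoly.mono u ∈ c.relIdeal y (N + 1) := by
  obtain ⟨g, hg, h, hh, rfl⟩ := TwoSidedIdeal.mem_sup.1 (c.relIdeal_le_sup y N hf)
  obtain ⟨b, hb⟩ := hN.exists_of_mem (h i j) (MatPoly.mem_high.1 hh i j)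
  refine ⟨b, ?_⟩
  rw [MatPoly.add_apply, map_add, add_sub_assoc]
  refine TwoSidedIdeal.add_mem _ ?_ hb
  rw [← MatPoly.one_mul_mul_one]
  exact TwoSidedIdeal.mul_mem_right _ _ _ (TwoSidedIdeal.mul_mem_left _ _ _ hg)

/-- The error of an expansion at stage `N` lies in the kernel of H̄_{N+1} → H̄_N, so chosen words of
degree `N + 1` correct it without altering the earlier coefficients. -/
theorem exists_mono_sub_sum_words_mem {N : ℕ} (hN : ∀ n < N, c.Spanning y n) {i j : Fin r}
    (s : Monomial l i j) (hs : 0 < s.degree) : ∃ b : Monomial l i j → k,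
      MatPoly.mono s - ∑ u ∈ c.words (N + 1) i j, b u • MatPoly.mono u ∈ c.relIdeal y N := by
  classical
  induction N with
  | zero => exact ⟨0, by simpa using c.mono_mem_relIdeal y 0 s hs⟩
  | succ N ih =>
    obtain ⟨b, hb⟩ := ih fun n hn => hN n (by omega)
    obtain ⟨b', hb'⟩ := exists_of_mem_relIdeal (hN N (by omega)) hb i j
    -- The error involves only words of type `(i, j)`, so it equals its own corner.
    have hcor : MatPoly.mono s - ∑ u ∈ c.words (N + 1) i j, b u • MatPoly.mono u =
        MatPoly.corner i j ((MatPoly.mono s - ∑ u ∈ c.words (N + 1) i j, b u • MatPoly.mono u :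
          MatPoly k l) i j) := by
      have : (MatPoly.mono s - ∑ u ∈ c.words (N + 1) i j, b u • MatPoly.mono u : MatPoly k l) =
          MatPoly.corner i j (Finsupp.single s 1 -
            ∑ u ∈ c.words (N + 1) i j, b u • Finsupp.single u 1) := by
        simp only [map_sub, map_sum, map_smul, MatPoly.mono_eq_corner]
      rw [this, MatPoly.corner_apply_same]
    rw [← hcor] at hb'
    refine ⟨fun u => if u ∈ c.words (N + 1) i j then b u else b' u, ?_⟩
    rw [sum_words_succ, ← sub_sub]
    have h1 : ∀ u ∈ c.words (N + 1) i j,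
        (if u ∈ c.words (N + 1) i j then b u else b' u) • (MatPoly.mono u : MatPoly k l) =
          b u • MatPoly.mono u := fun u hu => by rw [if_pos hu]
    have h2 : ∀ u ∈ c.B (N + 1) i j,
        (if u ∈ c.words (N + 1) i j then b u else b' u) • (MatPoly.mono u : MatPoly k l) =
          b' u • MatPoly.mono u := fun u hu => by
      rw [if_neg]
      intro h
      have h1 := c.degree_eq _ _ _ _ hu
      have h2 := (c.mem_words.1 h).2.1
      omega
    rw [Finset.sum_congr rfl h1, Finset.sum_congr rfl h2]
    exact hb'

variable (y c) in
/-- The coefficients of the words in the basis of chosen words modulo `relIdeal y N`. -/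
def IsCoeff (N : ℕ) (β : ∀ {i j : Fin r}, Monomial l i j → Monomial l i j → k) : Prop :=
  ∀ (i j : Fin r) (s : Monomial l i j), 0 < s.degree →
    MatPoly.mono s - ∑ u ∈ c.words (N + 1) i j, β s u • MatPoly.mono u ∈ c.relIdeal y N

/-- The heart of existence: the relations f_q are designed so that this sum has zero class modulo im
d. Each coordinate of the class is the coefficient of `u` in the expansion of f_q, which is zero in
H̄_N. -/
theorem sum_cup_mem_range {N : ℕ} (hN : ∀ n < N, c.Independent y n)
    {β : ∀ {i j : Fin r}, Monomial l i j → Monomial l i j → k} (hβ : c.IsCoeff y N β)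
    {i j : Fin r} {u : Monomial l i j} (hu : u ∈ c.words (N + 1) i j) :
    ∑ p ∈ c.pairs N i j, β (p.2.1.mul p.2.2) u • L.cup i p.1 j (c.v p.2.1) (c.v p.2.2) ∈
      LinearMap.range (L.d i j) := by
  rw [← Submodule.Quotient.mk_eq_zero]
  refine (y i j).ext_elem fun q => ?_
  change (y i j).coord q _ = (y i j).coord q 0
  rw [map_zero]
  let e : (L.W i j) →ₗ[k] k := (y i j).coord q ∘ₗ (LinearMap.range (L.d i j)).mkQ
  change e _ = 0
  rw [map_sum]
  simp only [map_smul, smul_eq_mul]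
  -- Replacing each product `st` in f_q by its expansion changes f_q by an element of the ideal, so
  -- the resulting combination of basis words is still zero.
  refine eq_zero_of_sum_words_mem hN (fun u => ∑ p ∈ c.pairs N i j, β (p.2.1.mul p.2.2) u *
    e (L.cup i p.1 j (c.v p.2.1) (c.v p.2.2))) ?_ u hu
  have h1 := c.rel_mem_relIdeal y N i j q
  rw [rel_eq_sum_pairs] at h1
  have h2 : ∑ p ∈ c.pairs N i j, e (L.cup i p.1 j (c.v p.2.1) (c.v p.2.2)) •
      (MatPoly.mono (p.2.1.mul p.2.2) -
        ∑ u ∈ c.words (N + 1) i j, β (p.2.1.mul p.2.2) u • MatPoly.mono u) ∈ c.relIdeal y N := by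
    refine TwoSidedIdeal.finsetSum_mem _ _ _ fun p hp => MatPoly.smul_mem _ (hβ _ _ _ ?_)
    rw [mem_pairs, mem_words] at hp
    rw [Monomial.degree_mul]
    omega
  have h3 := TwoSidedIdeal.sub_mem _ h1 h2
  convert h3 using 1
  simp only [smul_sub, Finset.sum_sub_distrib, Finset.sum_smul, Finset.smul_sum, smul_smul]
  rw [Finset.sum_comm]
  simp only [mul_comm (e _)]
  exact (sub_sub_cancel _ _).symm

end Choices

/-! ### Carrying out the algorithm stage by stage -/

namespace Choices

variable {k : Type u} [Field k] {r : ℕ} {L : GMMPAlgebra.{u, v, w} k r}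
  {l : Fin r → Fin r → ℕ} {I : Fin r → Fin r → Type*}
  {y : ∀ i j, Module.Basis (I i j) k (L.W i j ⧸ LinearMap.range (L.d i j))}

/-- Two runs of the algorithm agree up to degree `N`. -/
structure Agree (N : ℕ) (c c' : Choices L l) : Prop where
  B_eq : ∀ n ≤ N, c.B n = c'.B n
  v_eq : ∀ (i j : Fin r) (s : Monomial l i j), s.degree ≤ N → c.v s = c'.v s

namespace Agree

variable {N : ℕ} {c c' c'' : Choices L l}

theorem refl (N : ℕ) (c : Choices L l) : Agree N c c := ⟨fun _ _ => rfl, fun _ _ _ _ => rfl⟩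

theorem trans (h : Agree N c c') (h' : Agree N c' c'') : Agree N c c'' :=
  ⟨fun n hn => (h.B_eq n hn).trans (h'.B_eq n hn),
    fun i j s hs => (h.v_eq i j s hs).trans (h'.v_eq i j s hs)⟩

theorem mono {N' : ℕ} (h : Agree N c c') (hN : N' ≤ N) : Agree N' c c' :=
  ⟨fun n hn => h.B_eq n (hn.trans hN), fun i j s hs => h.v_eq i j s (hs.trans hN)⟩

theorem rel_eq (h : Agree N c c') (i j : Fin r) (q : I i j) :
    c.rel y (N + 1) i j q = c'.rel y (N + 1) i j q := by
  unfold rel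
  refine Finset.sum_congr rfl fun a ha => Finset.sum_congr rfl fun b hb =>
    Finset.sum_congr rfl fun m _ => ?_
  rw [Finset.mem_Ico] at ha hb
  rw [h.B_eq a (by omega), h.B_eq b (by omega)]
  refine Finset.sum_congr rfl fun s hs => Finset.sum_congr rfl fun t ht => ?_
  rw [h.v_eq _ _ s (by rw [c'.degree_eq _ _ _ _ hs]; omega),
    h.v_eq _ _ t (by rw [c'.degree_eq _ _ _ _ ht]; omega)]

/-- Only chosen words of degree at most `N` and their cochains enter stage `N + 1`, so B_{N+1} and
its cochains may be changed without moving the ideal. -/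
theorem relIdeal_eq (h : Agree N c c') : c.relIdeal y (N + 1) = c'.relIdeal y (N + 1) := by
  simp only [relIdeal, h.rel_eq]

theorem words_eq (h : Agree N c c') (i j : Fin r) : c.words (N + 1) i j = c'.words (N + 1) i j := by
  ext s
  rw [mem_words, mem_words]
  constructor
  · rintro ⟨h1, h2, h3⟩
    exact ⟨h1, h2, by rwa [← h.B_eq _ (by omega)]⟩
  · rintro ⟨h1, h2, h3⟩
    exact ⟨h1, h2, by rwa [h.B_eq _ (by omega)]⟩

theorem independent (h : Agree N c c') (hB : c.B (N + 1) = c'.B (N + 1))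
    (hc : c.Independent y N) : c'.Independent y N := by
  unfold Independent at hc ⊢
  rwa [← hB, ← h.relIdeal_eq]

theorem spanning (h : Agree N c c') (hB : c.B (N + 1) = c'.B (N + 1))
    (hc : c.Spanning y N) : c'.Spanning y N := by
  unfold Spanning at hc ⊢
  rwa [← hB, ← h.relIdeal_eq]

theorem isCoeff (h : Agree N c c') (hB : c.B (N + 1) = c'.B (N + 1))
    {β : ∀ {i j : Fin r}, Monomial l i j → Monomial l i j → k}
    (hc : c.IsCoeff y (N + 1) β) : c'.IsCoeff y (N + 1) β := by
  intro i j s hs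
  have := hc i j s hs
  rwa [sum_words_succ, hB, h.words_eq, h.relIdeal_eq, ← sum_words_succ] at this

end Agree

variable (y) in
/-- Stage `N + 1` of the algorithm has been carried out correctly. -/
structure Stage (c : Choices L l) (N : ℕ) : Prop where
  independent : c.Independent y N
  spanning : c.Spanning y N
  exists_coeff : ∃ β : ∀ {i j : Fin r}, Monomial l i j → Monomial l i j → k,
    c.IsCoeff y (N + 1) β ∧ (1 ≤ N → ∀ (i j : Fin r), ∀ u ∈ c.B (N + 1) i j,
      L.d i j (c.v u) = -∑ p ∈ c.pairs (N + 1) i j,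
        β (p.2.1.mul p.2.2) u • L.cup i p.1 j (c.v p.2.1) (c.v p.2.2))

theorem Stage.congr {N : ℕ} {c c' : Choices L l} (h : Agree (N + 1) c c') (hc : c.Stage y N) :
    c'.Stage y N := by
  have h' := h.mono N.le_succ
  have hB := h.B_eq (N + 1) le_rfl
  refine ⟨h'.independent hB hc.independent, h'.spanning hB hc.spanning, ?_⟩
  obtain ⟨β, hβ, hd⟩ := hc.exists_coeff
  refine ⟨β, h'.isCoeff hB hβ, fun hN i j u hu => ?_⟩
  rw [← hB] at hu
  rw [← h.v_eq i j u (c.degree_eq _ _ _ _ hu).le, hd hN i j u hu]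
  have hp : c.pairs (N + 1) i j = c'.pairs (N + 1) i j := by simp only [pairs, h'.words_eq]
  rw [hp]
  congr 1
  refine Finset.sum_congr rfl fun p hp => ?_
  rw [mem_pairs, mem_words, mem_words] at hp
  rw [h.v_eq _ _ p.2.1 (by omega), h.v_eq _ _ p.2.2 (by omega)]

variable (y) in
-- There are finitely many words of each degree, so a maximal independent subfamily of their classes
-- is finite.
theorem exists_finset_basis (c : Choices L l) (N : ℕ) (i j : Fin r) :
    ∃ B : Finset (Monomial l i j), (∀ s ∈ B, s.degree = N + 1) ∧
      (∀ b : Monomial l i j → k, ∑ s ∈ B, b s • MatPoly.mono s ∈ c.relIdeal y (N + 1) →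
        ∀ s ∈ B, b s = 0) ∧
      ∀ s : Monomial l i j, s.degree = N + 1 → ∃ b : Monomial l i j → k,
        MatPoly.mono s - ∑ u ∈ B, b u • MatPoly.mono u ∈ c.relIdeal y (N + 1) := by
  classical
  let f : {s : Monomial l i j // s.degree = N + 1} → c.HBar y (N + 1) :=
    fun s => c.quot y (N + 1) (MatPoly.mono s.1)
  obtain ⟨κ, a, ha, hspan, hli⟩ := exists_linearIndependent' k f
  have : Finite {s : Monomial l i j // s.degree = N + 1} :=
    Monomial.finite_setOf_degree_eq (N + 1) i j
  have : Finite κ := Finite.of_injective a ha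
  have := Fintype.ofFinite κ
  have hinj : Function.Injective fun x : κ => (a x).1 := Subtype.val_injective.comp ha
  have hsum : ∀ b : Monomial l i j → k,
      ∑ s ∈ Finset.univ.image (fun x : κ => (a x).1), b s • (MatPoly.mono s : MatPoly k l) =
        ∑ x : κ, b (a x).1 • MatPoly.mono (a x).1 := fun b =>
    Finset.sum_image fun _ _ _ _ h => hinj h
  refine ⟨Finset.univ.image fun x : κ => (a x).1, ?_, ?_, ?_⟩
  · intro s hs
    obtain ⟨x, -, rfl⟩ := Finset.mem_image.1 hs
    exact (a x).2
  · intro b hb s hs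
    obtain ⟨x, -, rfl⟩ := Finset.mem_image.1 hs
    rw [hsum, ← c.quot_eq_zero, map_sum] at hb
    simp only [map_smul] at hb
    exact Fintype.linearIndependent_iff.1 hli (fun x => b (a x).1) hb x
  · intro s hs
    have hmem : f ⟨s, hs⟩ ∈ Submodule.span k (Set.range (f ∘ a)) := by
      rw [hspan]
      exact Submodule.subset_span ⟨_, rfl⟩
    obtain ⟨g, hg⟩ := (Submodule.mem_span_range_iff_exists_fun k).1 hmem
    refine ⟨fun u => ∑ x : κ, if (a x).1 = u then g x else 0, ?_⟩
    rw [hsum, ← c.quot_eq_zero, map_sub, map_sum, sub_eq_zero]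
    change f ⟨s, hs⟩ = _
    rw [← hg]
    refine Finset.sum_congr rfl fun x _ => ?_
    rw [map_smul, Finset.sum_eq_single x]
    · simp [f]
    · intro x' _ hx'
      exact if_neg fun h => hx' (hinj h)
    · simp

/-- The order matters: B_{N+1} is fixed first, then β, and finally the cochains in degree `N + 1`.
None of these affects the ideal of stage `N + 1`. -/
theorem exists_stage {N : ℕ} {c : Choices L l} (hc : ∀ n < N, c.Stage y n) :
    ∃ c' : Choices L l, Agree N c c' ∧ c'.Stage y N ∧
      ∀ (i j : Fin r) (p : Fin (l i j)), c'.v (Monomial.var p) = c.v (Monomial.var p) := by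
  classical
  choose B hdeg hind hspan using c.exists_finset_basis y N
  let c₁ : Choices L l :=
    { B := Function.update c.B (N + 1) B
      v := c.v
      degree_eq := fun n i j s hs => by
        by_cases hn : n = N + 1
        · subst hn
          rw [Function.update_self] at hs
          exact hdeg i j s hs
        · rw [Function.update_of_ne hn] at hs
          exact c.degree_eq n i j s hs }
  have hB : c₁.B (N + 1) = B := Function.update_self _ _ _
  have h₁ : Agree N c c₁ :=
    ⟨fun n hn => (Function.update_of_ne (by omega) _ _).symm, fun _ _ _ _ => rfl⟩
  have hind₁ : c₁.Independent y N := by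
    unfold Independent
    rw [hB, ← h₁.relIdeal_eq]
    exact hind
  have hspan₁ : c₁.Spanning y N := by
    unfold Spanning
    rw [hB, ← h₁.relIdeal_eq]
    exact hspan
  have hlow : ∀ n < N, c₁.Stage y n := fun n hn => (hc n hn).congr (h₁.mono hn)
  have hind' : ∀ n < N + 1, c₁.Independent y n := fun n hn => by
    rcases Nat.lt_succ_iff_lt_or_eq.1 hn with h | rfl
    exacts [(hlow n h).independent, hind₁]
  have hspan' : ∀ n < N + 1, c₁.Spanning y n := fun n hn => by
    rcases Nat.lt_succ_iff_lt_or_eq.1 hn with h | rfl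
    exacts [(hlow n h).spanning, hspan₁]
  have hex : ∀ (i j : Fin r) (s : Monomial l i j), ∃ b : Monomial l i j → k, 0 < s.degree →
      MatPoly.mono s - ∑ u ∈ c₁.words (N + 1 + 1) i j, b u • MatPoly.mono u ∈
        c₁.relIdeal y (N + 1) := fun i j s => by
    by_cases hs : 0 < s.degree
    · obtain ⟨b, hb⟩ := exists_mono_sub_sum_words_mem hspan' s hs
      exact ⟨b, fun _ => hb⟩
    · exact ⟨0, fun h => absurd h hs⟩
  choose β hβ using hex
  have hβ₁ : c₁.IsCoeff y (N + 1) (fun {i j} => β i j) := hβ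
  by_cases hN : 1 ≤ N
  · have hd : ∀ (i j : Fin r) (u : Monomial l i j), ∃ z : L.V i j, u ∈ c₁.B (N + 1) i j →
        L.d i j z = -∑ p ∈ c₁.pairs (N + 1) i j,
          β i j (p.2.1.mul p.2.2) u • L.cup i p.1 j (c₁.v p.2.1) (c₁.v p.2.2) := fun i j u => by
      by_cases hu : u ∈ c₁.B (N + 1) i j
      · have hdu := c₁.degree_eq _ _ _ _ hu
        have hu' : u ∈ c₁.words (N + 1 + 1) i j :=
          c₁.mem_words.2 ⟨by omega, by omega, hdu.symm ▸ hu⟩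
        obtain ⟨z, hz⟩ := neg_mem (sum_cup_mem_range hind' hβ₁ hu')
        exact ⟨z, fun _ => hz⟩
      · exact ⟨0, fun h => absurd h hu⟩
    choose z hz using hd
    -- Only the cochains of degree `N + 1` are replaced. As `N ≥ 1`, those of the variables stay as
    -- they were.
    let c₂ : Choices L l :=
      { B := c₁.B
        v := fun {i j} u => if u.degree = N + 1 then z i j u else c.v u
        degree_eq := c₁.degree_eq }
    have h₂ : Agree N c₁ c₂ :=
      ⟨fun _ _ => rfl, fun i j s hs => (if_neg (by omega)).symm⟩
    refine ⟨c₂, h₁.trans h₂, ⟨h₂.independent rfl hind₁, h₂.spanning rfl hspan₁,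
      fun {i j} => β i j, h₂.isCoeff rfl hβ₁, fun _ i j u hu => ?_⟩, fun i j p => ?_⟩
    · have hdu := c₂.degree_eq _ _ _ _ hu
      have hv : c₂.v u = z i j u := if_pos hdu
      rw [hv, hz i j u hu]
      have hp : c₁.pairs (N + 1) i j = c₂.pairs (N + 1) i j := rfl
      rw [hp]
      congr 1
      refine Finset.sum_congr rfl fun p hp => ?_
      rw [mem_pairs, mem_words, mem_words] at hp
      rw [h₂.v_eq _ _ p.2.1 (by omega), h₂.v_eq _ _ p.2.2 (by omega)]
    · exact if_neg (by rw [Monomial.degree_var]; omega)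
  -- In degree 1 there is no equation to solve, and the prescribed cochains are kept.
  · exact ⟨c₁, h₁, ⟨hind₁, hspan₁, fun {i j} => β i j, hβ₁, fun h => absurd h hN⟩,
      fun _ _ _ => rfl⟩

/-- The values of `v` before the first stage. -/
def initialV (x : ∀ i j, Fin (l i j) → L.V i j) : ∀ {i j : Fin r}, Monomial l i j → L.V i j
  | _, _, .one _ => 0
  | _, _, .cons p (.one _) => x _ _ p
  | _, _, .cons _ (.cons _ _) => 0

variable (y) in
-- Dependent choice gives runs agreeing in growing ranges of degrees.
theorem exists_forall_stage (x : ∀ i j, Fin (l i j) → L.V i j) :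
    ∃ c : Choices L l, (∀ N, c.Stage y N) ∧
      ∀ (i j : Fin r) (p : Fin (l i j)), c.v (Monomial.var p) = x i j p := by
  let Good (N : ℕ) (c : Choices L l) : Prop := (∀ n < N, c.Stage y n) ∧
    ∀ (i j : Fin r) (p : Fin (l i j)), c.v (Monomial.var p) = x i j p
  have step : ∀ (N : ℕ) (c : {c // Good N c}), ∃ c' : {c // Good (N + 1) c},
      Agree N c.1 c'.1 := by
    rintro N ⟨c, hc, hx⟩
    obtain ⟨c', h1, h2, h3⟩ := exists_stage hc
    refine ⟨⟨c', fun n hn => ?_, fun i j p => (h3 i j p).trans (hx i j p)⟩, h1⟩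
    rcases Nat.lt_succ_iff_lt_or_eq.1 hn with h | rfl
    exacts [(hc n h).congr (h1.mono h), h2]
  choose next hnext using step
  let seq : ∀ N, {c // Good N c} := Nat.rec
    ⟨{ B := fun _ _ _ => ∅, v := initialV x, degree_eq := by simp },
      fun n hn => absurd hn n.not_lt_zero, fun _ _ _ => rfl⟩ next
  have hseq : ∀ N M, N ≤ M → Agree N (seq N).1 (seq M).1 := fun N M h => by
    induction M, h using Nat.le_induction with
    | base => exact Agree.refl _ _
    | succ M hM ih => exact ih.trans ((hnext M (seq M)).mono hM)
  -- The diagonal run: data of degree `n` are taken from the `n`-th run and never change afterwards.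
  let c : Choices L l :=
    { B := fun n => (seq n).1.B n
      v := fun {i j} s => (seq s.degree).1.v s
      degree_eq := fun n => (seq n).1.degree_eq n }
  have hagree : ∀ N, Agree N (seq N).1 c := fun N =>
    ⟨fun n hn => ((hseq n N hn).B_eq n le_rfl).symm,
      fun i j s hs => ((hseq _ N hs).v_eq i j s le_rfl).symm⟩
  exact ⟨c, fun N => ((seq (N + 1)).2.1 N N.lt_succ_self).congr (hagree (N + 1)),
    fun i j p => (seq 1).2.2 i j p⟩

end Choices

/-! ### Every sequence of stages gives a computation -/

namespace Computation

open Choices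

variable {k : Type u} [Field k] {r : ℕ} {L : GMMPAlgebra.{u, v, w} k r}
  {l : Fin r → Fin r → ℕ} {I : Fin r → Fin r → Type*}

theorem nonempty (x : ∀ i j, Fin (l i j) → L.V i j)
    (y : ∀ i j, Module.Basis (I i j) k (L.W i j ⧸ LinearMap.range (L.d i j))) :
    Nonempty (Computation x y) := by
  classical
  obtain ⟨c, hc, hx⟩ := exists_forall_stage y x
  have hex : ∀ N, ∃ β : ∀ i j : Fin r, Monomial l i j → Monomial l i j → k,
      c.IsCoeff y N (fun {i j} => β i j) ∧ (2 ≤ N → ∀ (i j : Fin r), ∀ u ∈ c.B N i j,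
        L.d i j (c.v u) = -∑ p ∈ c.pairs N i j,
          β i j (p.2.1.mul p.2.2) u • L.cup i p.1 j (c.v p.2.1) (c.v p.2.2)) := by
    -- In H̄_0 all words of positive degree vanish, so the coefficients can be taken to be zero.
    rintro (_ | N)
    · exact ⟨0, fun i j s hs => by simpa using c.mono_mem_relIdeal y 0 s hs,
        fun h => absurd h (by omega)⟩
    · obtain ⟨β, h1, h2⟩ := (hc N).exists_coeff
      exact ⟨fun i j => β, h1, fun h => h2 (by omega)⟩
  choose β hβ hd using hex
  refine ⟨
    { toChoices := c
      v_var := hx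
      linearIndependent := fun N => ?_
      span_eq := fun N => ?_
      β := fun N {i j} => β N i j
      quot_eq_sum := fun N i j s hs => ?_
      d_v := fun N hN i j u hu => ?_ }⟩
  · refine Fintype.linearIndependent_iff.2 fun g hg => ?_
    let b : ∀ i j, Monomial l i j → k := fun i j s =>
      if h : s ∈ c.B (N + 1) i j then g ⟨i, j, s, h⟩ else 0
    -- A relation mixing all types is packed into one matrix; its corners then lie in the ideal and
    -- separate the types.
    let f : MatPoly k l := fun i j => ∑ s ∈ c.B (N + 1) i j, b i j s • Finsupp.single s 1
    have hf : f ∈ c.relIdeal y (N + 1) := by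
      rw [← c.quot_eq_zero, ← hg, MatPoly.eq_sum_corner f]
      simp only [f, map_sum, map_smul, Fintype.sum_sigma]
      refine Finset.sum_congr rfl fun i _ => Finset.sum_congr rfl fun j _ => ?_
      rw [← Finset.sum_coe_sort]
      exact Finset.sum_congr rfl fun s _ => by
        rw [← MatPoly.mono_eq_corner]
        simp only [b, dif_pos s.2]
    rintro ⟨i, j, s, hs⟩
    have hij : ∑ s ∈ c.B (N + 1) i j, b i j s • MatPoly.mono s ∈ c.relIdeal y (N + 1) := by
      have h : MatPoly.corner i j (f i j) ∈ c.relIdeal y (N + 1) := by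
        rw [← MatPoly.one_mul_mul_one]
        exact TwoSidedIdeal.mul_mem_right _ _ _ (TwoSidedIdeal.mul_mem_left _ _ _ hf)
      simpa only [f, map_sum, map_smul, ← MatPoly.mono_eq_corner] using h
    have := (hc N).independent i j (b i j) hij s hs
    simpa only [b, dif_pos hs] using this
  · refine le_antisymm (Submodule.span_le.2 ?_) fun z hz => ?_
    · rintro _ ⟨⟨i, j, s, hs⟩, rfl⟩
      change c.trans y N (c.quot y (N + 1) (MatPoly.mono s)) = 0
      rw [trans_quot, quot_eq_zero]
      exact c.mono_mem_relIdeal y N s (by rw [c.degree_eq _ _ _ _ hs]; omega)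
    · obtain ⟨f, rfl⟩ := c.quot_surjective y (N + 1) z
      have hf : f ∈ c.relIdeal y N := by
        rw [← quot_eq_zero, ← trans_quot]
        exact hz
      rw [MatPoly.eq_sum_corner f, map_sum]
      refine Submodule.sum_mem _ fun i _ => ?_
      rw [map_sum]
      refine Submodule.sum_mem _ fun j _ => ?_
      obtain ⟨b, hb⟩ := exists_of_mem_relIdeal (hc N).spanning hf i j
      rw [← quot_eq_zero, map_sub, sub_eq_zero, map_sum] at hb
      rw [hb]
      refine Submodule.sum_mem _ fun s hs => ?_
      rw [map_smul]
      exact Submodule.smul_mem _ _ (Submodule.subset_span ⟨⟨i, j, s, hs⟩, rfl⟩)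
  · have h := hβ N i j s hs
    rw [← quot_eq_zero, map_sub, sub_eq_zero, sum_words] at h
    simpa only [map_sum, map_smul] using h
  · rw [hd N hN i j u hu]
    congr 1
    exact c.sum_pairs N fun m s t => β N i j (s.mul t) u • L.cup i m j (c.v s) (c.v t)

end Computation

/-! ### Infinite series in Ĥ -/

namespace Choices

variable {k : Type u} [Field k] {r : ℕ} {L : GMMPAlgebra.{u, v, w} k r}
  {l : Fin r → Fin r → ℕ} {I : Fin r → Fin r → Type*}
  (y : ∀ i j, Module.Basis (I i j) k (L.W i j ⧸ LinearMap.range (L.d i j)))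
  (c : Choices L l)

variable {y c} in
theorem HHat.ext {g h : c.HHat y} (H : ∀ N, c.proj y N g = c.proj y N h) : g = h :=
  Subtype.ext (funext H)

/-- The element `∑ a_u u` of `Ĥ`, summed over all chosen words `u` of type `(i, j)` and of
positive degree. -/
def series (i j : Fin r) : (Monomial l i j → k) →ₗ[k] c.HHat y where
  toFun a := (⟨fun N => ∑ u ∈ c.words (N + 1) i j, a u • c.quot y N (MatPoly.mono u), fun N => by
    simp only [map_sum, map_smul, trans_quot]
    -- The additional words have degree `N + 1` and vanish in H̄_N, so the truncations are
    -- compatible.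
    refine (Finset.sum_subset (c.words_mono N.succ.le_succ i j) fun u hu hu' => ?_).symm
    rw [(c.quot_eq_zero y N _).2, smul_zero]
    refine c.mono_mem_relIdeal y N u ?_
    by_contra h
    rw [mem_words] at hu hu'
    exact hu' ⟨hu.1, by omega, hu.2.2⟩⟩ : c.limit y)
  map_add' a b := HHat.ext fun N => by
    change ∑ u ∈ c.words (N + 1) i j, (a + b) u • c.quot y N (MatPoly.mono u) =
      ∑ u ∈ c.words (N + 1) i j, a u • c.quot y N (MatPoly.mono u) +
        ∑ u ∈ c.words (N + 1) i j, b u • c.quot y N (MatPoly.mono u)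
    simp only [Pi.add_apply, add_smul, Finset.sum_add_distrib]
  map_smul' e a := HHat.ext fun N => by
    change ∑ u ∈ c.words (N + 1) i j, (e • a) u • c.quot y N (MatPoly.mono u) =
      e • ∑ u ∈ c.words (N + 1) i j, a u • c.quot y N (MatPoly.mono u)
    simp only [Pi.smul_apply, smul_assoc, Finset.smul_sum]

theorem proj_series (N : ℕ) {i j : Fin r} (a : Monomial l i j → k) :
    c.proj y N (c.series y i j a) =
      ∑ u ∈ c.words (N + 1) i j, a u • c.quot y N (MatPoly.mono u) := rfl

theorem series_eq_zero {i j : Fin r} {a : Monomial l i j → k}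
    (ha : ∀ u, 1 ≤ u.degree → u ∈ c.B u.degree i j → a u = 0) : c.series y i j a = 0 :=
  HHat.ext fun N => by
    rw [proj_series, map_zero]
    refine Finset.sum_eq_zero fun u hu => ?_
    rw [mem_words] at hu
    rw [ha u hu.1 hu.2.2, zero_smul]

theorem toHHat_one_mul_series {i j : Fin r} (a : Monomial l i j → k) :
    c.toHHat y (MatPoly.mono (Monomial.one i)) * c.series y i j a = c.series y i j a :=
  HHat.ext fun N => by
    rw [map_mul, proj_toHHat, proj_series, Finset.mul_sum]
    refine Finset.sum_congr rfl fun u _ => ?_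
    rw [mul_smul_comm, ← map_mul, MatPoly.mono_mul_mono, Monomial.one_mul]

theorem proj_series_mul_series (N : ℕ) {i m j : Fin r} (a : Monomial l i m → k)
    (b : Monomial l m j → k) : c.proj y N (c.series y i m a * c.series y m j b) =
      ∑ s ∈ c.words (N + 1) i m, ∑ t ∈ c.words (N + 1) m j,
        (a s * b t) • c.quot y N (MatPoly.mono (s.mul t)) := by
  rw [map_mul, proj_series, proj_series, Finset.sum_mul_sum]
  refine Finset.sum_congr rfl fun s _ => Finset.sum_congr rfl fun t _ => ?_
  rw [smul_mul_smul_comm, ← map_mul, MatPoly.mono_mul_mono]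

theorem augHat_series {i j : Fin r} (a : Monomial l i j → k) :
    c.augHat y (c.series y i j a) = 0 := by
  change c.augBar y (c.proj y 0 (c.series y i j a)) = 0
  rw [proj_series, Finset.sum_eq_zero, map_zero]
  intro u hu
  rw [mem_words] at hu
  omega

theorem const_smul_HBar (N : ℕ) (a : k) (h : c.HBar y N) :
    (fun _ => a : Fin r → k) • h = a • h := by
  obtain ⟨f, rfl⟩ := c.quot_surjective y N h
  have := congrArg (c.proj y N) (c.const_smul_HHat y a (c.toHHat y f))
  rwa [smul_HHat_def, map_mul, map_smul, proj_toHHat, proj_toHHat, ← smul_HBar_def] at this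

end Choices

/-! ### The Maurer-Cartan equation -/

namespace Computation

open Choices

variable {k : Type u} [Field k] {r : ℕ} {L : GMMPAlgebra.{u, v, w} k r}
  {l : Fin r → Fin r → ℕ} {I : Fin r → Fin r → Type*}
  {x : ∀ i j, Fin (l i j) → L.V i j}
  {y : ∀ i j, Module.Basis (I i j) k (L.W i j ⧸ LinearMap.range (L.d i j))}
  (H : Computation x y)

theorem independent (N : ℕ) : H.toChoices.Independent y N := by
  classical
  intro i j b hb s hs
  have hinj : Function.Injective fun t : {s : Monomial l i j // s ∈ H.B (N + 1) i j} =>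
      (⟨i, j, t⟩ : Σ i j, {s : Monomial l i j // s ∈ H.B (N + 1) i j}) := fun t t' h => by
    simpa using h
  have hli := (H.linearIndependent N).comp _ hinj
  refine Fintype.linearIndependent_iff.1 hli (fun t => b t.1) ?_ ⟨s, hs⟩
  rw [← quot_eq_zero, map_sum, ← Finset.sum_coe_sort] at hb
  simp only [map_smul] at hb
  exact hb

theorem isCoeff (N : ℕ) : H.toChoices.IsCoeff y N (H.β N) := by
  intro i j s hs
  rw [← quot_eq_zero, map_sub, sub_eq_zero, sum_words, H.quot_eq_sum N i j s hs]
  simp only [map_sum, map_smul]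

theorem quot_mono {N : ℕ} {i j : Fin r} (s : Monomial l i j) (hs : 0 < s.degree) :
    H.quot y N (MatPoly.mono s) =
      ∑ u ∈ H.words (N + 1) i j, H.β N s u • H.quot y N (MatPoly.mono u) := by
  rw [H.quot_eq_sum N i j s hs, sum_words]

/-- Projecting the expansion in H̄_N to H̄_n kills the words of degree above `n`, and the expansion
in H̄_n is unique. -/
theorem β_eq_of_le {n N : ℕ} (hn : n ≤ N) {i j : Fin r} (s : Monomial l i j) (hs : 0 < s.degree)
    {u : Monomial l i j} (hu : u ∈ H.words (n + 1) i j) : H.β N s u = H.β n s u := by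
  classical
  have h1 := H.relIdeal_antitone y hn (H.isCoeff N i j s hs)
  have h2 := TwoSidedIdeal.sub_mem _ (H.isCoeff n i j s hs) h1
  have h3 : ∑ u ∈ H.words (N + 1) i j \ H.words (n + 1) i j, H.β N s u • MatPoly.mono u ∈
      H.relIdeal y n := by
    refine TwoSidedIdeal.finsetSum_mem _ _ _ fun u hu => MatPoly.smul_mem _ ?_
    refine H.mono_mem_relIdeal y n u ?_
    rw [Finset.mem_sdiff, mem_words, mem_words] at hu
    by_contra h
    exact hu.2 ⟨hu.1.1, by omega, hu.1.2.2⟩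
  rw [sub_sub_sub_cancel_left, ← Finset.sum_sdiff (H.words_mono (Nat.succ_le_succ hn) i j),
    add_sub_assoc] at h2
  have h4 := TwoSidedIdeal.sub_mem _ h2 h3
  rw [add_sub_cancel_left, ← Finset.sum_sub_distrib] at h4
  simp only [← sub_smul] at h4
  exact sub_eq_zero.1 (eq_zero_of_sum_words_mem (fun m _ => H.independent m)
    (fun u => H.β N s u - H.β n s u) h4 u hu)

theorem β_eq_zero {n : ℕ} {i j : Fin r} (s : Monomial l i j) (hs : n < s.degree)
    {u : Monomial l i j} (hu : u ∈ H.words (n + 1) i j) : H.β n s u = 0 := by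
  have h := TwoSidedIdeal.sub_mem _ (H.mono_mem_relIdeal y n s hs)
    (H.isCoeff n i j s (by omega))
  rw [sub_sub_cancel] at h
  exact eq_zero_of_sum_words_mem (fun m _ => H.independent m) _ h u hu

/-- In degree 1 both sides vanish: the variables carry cocycles, and no two words of positive degree
have degree less than 1. -/
theorem d_v_eq (hx : ∀ i j p, L.d i j (x i j p) = 0) {i j : Fin r} {u : Monomial l i j}
    (hu : 1 ≤ u.degree) (hu' : u ∈ H.B u.degree i j) :
    L.d i j (H.v u) = -∑ p ∈ H.pairs u.degree i j,
      H.β u.degree (p.2.1.mul p.2.2) u • L.cup i p.1 j (H.v p.2.1) (H.v p.2.2) := by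
  rcases Nat.lt_or_ge u.degree 2 with h | h
  · obtain ⟨p, rfl⟩ := u.exists_eq_var_of_degree_eq_one (by omega)
    rw [H.v_var, hx, Finset.sum_eq_zero, neg_zero]
    intro p hp
    rw [mem_pairs, mem_words] at hp
    omega
  · rw [H.d_v _ h i j u hu']
    congr 1
    exact (H.sum_pairs _ fun m s t => H.β u.degree (s.mul t) u • L.cup i m j (H.v s) (H.v t)).symm

/-- The equation for `v_u` uses the coefficients of stage `u.degree`; this is the same equation at
every later stage `N`. The coefficients agree, and the additional pairs have products too long to
involve `u`. -/
theorem sum_β_cup (hx : ∀ i j p, L.d i j (x i j p) = 0) {N : ℕ} {i j : Fin r}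
    {u : Monomial l i j} (hu : u ∈ H.words (N + 1) i j) :
    ∑ p ∈ H.pairs (N + 1) i j,
      H.β N (p.2.1.mul p.2.2) u • L.cup i p.1 j (H.v p.2.1) (H.v p.2.2) = -L.d i j (H.v u) := by
  rw [mem_words] at hu
  have hu' : u ∈ H.words (u.degree + 1) i j := H.mem_words.2 ⟨hu.1, by omega, hu.2.2⟩
  have hβ : ∀ p ∈ H.pairs (N + 1) i j,
      H.β N (p.2.1.mul p.2.2) u = H.β u.degree (p.2.1.mul p.2.2) u := fun p hp => by
    refine H.β_eq_of_le (by omega) _ ?_ hu'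
    rw [mem_pairs, mem_words] at hp
    rw [Monomial.degree_mul]
    omega
  rw [H.d_v_eq hx hu.1 hu.2.2, neg_neg, ← Finset.sum_subset (H.pairs_mono hu.2.1.le i j)]
  · exact Finset.sum_congr rfl fun p hp => by rw [hβ p (H.pairs_mono hu.2.1.le i j hp)]
  · intro p hp hp'
    rw [hβ p hp, H.β_eq_zero _ (H.le_degree_mul_of_notMem_pairs hp hp') hu', zero_smul]

/-- The Maurer-Cartan equation for `∑ u ⊗ v_u` in `H̄_N`, tested on a linear functional. -/
theorem maurerCartan_quot (hx : ∀ i j p, L.d i j (x i j p) = 0) (N : ℕ) {i j : Fin r}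
    (e : L.W i j →ₗ[k] k) :
    ∑ p ∈ H.pairs (N + 1) i j, e (L.cup i p.1 j (H.v p.2.1) (H.v p.2.2)) •
        H.quot y N (MatPoly.mono (p.2.1.mul p.2.2)) =
      -∑ u ∈ H.words (N + 1) i j, e (L.d i j (H.v u)) • H.quot y N (MatPoly.mono u) := by
  have h : ∀ p ∈ H.pairs (N + 1) i j, e (L.cup i p.1 j (H.v p.2.1) (H.v p.2.2)) •
      H.quot y N (MatPoly.mono (p.2.1.mul p.2.2)) = ∑ u ∈ H.words (N + 1) i j,
        e (H.β N (p.2.1.mul p.2.2) u • L.cup i p.1 j (H.v p.2.1) (H.v p.2.2)) •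
          H.quot y N (MatPoly.mono u) := fun p hp => by
    rw [H.quot_mono, Finset.smul_sum]
    · refine Finset.sum_congr rfl fun u _ => ?_
      rw [smul_smul, map_smul, smul_eq_mul, mul_comm]
    · rw [mem_pairs, mem_words] at hp
      rw [Monomial.degree_mul]
      omega
  rw [Finset.sum_congr rfl h, Finset.sum_comm, ← Finset.sum_neg_distrib]
  refine Finset.sum_congr rfl fun u hu => ?_
  rw [← Finset.sum_smul, ← map_sum, H.sum_β_cup hx hu, map_neg, neg_smul]

/-- The Maurer-Cartan equation for `∑ u ⊗ v_u` in `Ĥ`, tested on a linear functional whose values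
at products are given by a pairing of matrices of coefficients. -/
theorem maurerCartan (hx : ∀ i j p, L.d i j (x i j p) = 0) {i j : Fin r}
    (e : L.W i j →ₗ[k] k) {κ : Fin r → Type*} [∀ m, Fintype (κ m)]
    (a : ∀ m, κ m → Monomial l i m → k) (b : ∀ m, κ m → Monomial l m j → k)
    (hab : ∀ m s t, ∑ g, a m g s * b m g t = e (L.cup i m j (H.v s) (H.v t))) :
    ∑ m, ∑ g, H.series y i m (a m g) * H.series y m j (b m g) =
      -H.series y i j fun u => e (L.d i j (H.v u)) := by
  -- A product of two series is determined by its truncations, where it is a finite sum over pairs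
  -- of words.
  refine HHat.ext fun N => ?_
  rw [map_neg, proj_series, ← H.maurerCartan_quot hx N e,
    H.sum_pairs_eq_sum_words (N + 1) fun m s t => e (L.cup i m j (H.v s) (H.v t)) •
      H.quot y N (MatPoly.mono (s.mul t)), map_sum]
  refine Finset.sum_congr rfl fun m _ => ?_
  simp only [map_sum, proj_series_mul_series]
  rw [Finset.sum_comm]
  refine Finset.sum_congr rfl fun s _ => ?_
  rw [Finset.sum_comm]
  refine Finset.sum_congr rfl fun t _ => ?_
  rw [← Finset.sum_smul, hab]

/-- Modulo words of degree at least 2 there are no relations, so an omitted variable could not be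
expanded in the chosen ones: its own coefficient would remain 1. -/
theorem words_two_eq_image_var [∀ i j, DecidableEq (Monomial l i j)] (i j : Fin r) :
    H.words 2 i j = Finset.univ.image (Monomial.var : Fin (l i j) → Monomial l i j) := by
  ext u
  rw [Finset.mem_image]
  constructor
  · intro hu
    rw [mem_words] at hu
    obtain ⟨p, hp⟩ := u.exists_eq_var_of_degree_eq_one (by omega)
    exact ⟨p, Finset.mem_univ p, hp.symm⟩
  · rintro ⟨p, -, rfl⟩
    by_contra h
    have h1 := MatPoly.mem_high.1 (H.relIdeal_one_le_high y
      (H.isCoeff 1 i j (Monomial.var p) (by simp))) i j (Monomial.var p) (by simp)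
    have h2 : (MatPoly.mono (Monomial.var p) - ∑ u ∈ H.words 2 i j,
        H.β 1 (Monomial.var p) u • MatPoly.mono u : MatPoly k l) =
      MatPoly.corner i j (Finsupp.single (Monomial.var p) 1 - ∑ u ∈ H.words 2 i j,
        H.β 1 (Monomial.var p) u • Finsupp.single u 1) := by
      simp only [map_sub, map_sum, map_smul, MatPoly.mono_eq_corner]
    rw [h2, MatPoly.corner_apply_same, Finsupp.sub_apply, Finsupp.single_eq_same,
      Finsupp.finsetSum_apply, Finset.sum_eq_zero, sub_zero] at h1
    · exact one_ne_zero h1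
    · intro u hu
      rw [Finsupp.smul_apply, Finsupp.single_eq_of_ne, smul_zero]
      rintro rfl
      exact h hu

end Computation

/-! ### Ĥ-linear endomorphisms of Ĥ ⊗ (⊕ M_i) and homomorphisms into the completion -/

section HatTensor

variable {k : Type u} [Field k] {r : ℕ} {L : GMMPAlgebra.{u, v, w} k r}
  {l : Fin r → Fin r → ℕ} {I : Fin r → Fin r → Type*}
  {y : ∀ i j, Module.Basis (I i j) k (L.W i j ⧸ LinearMap.range (L.d i j))}
  {c : Choices L l}
  {M : Fin r → Type*} [∀ i, AddCommGroup (M i)] [∀ i, Module k (M i)]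

namespace HatTensor

variable (y c M) in
/-- The map `M_i → Ĥ ⊗_{k^r} (⊕ M_j)`, `m ↦ h ⊗ m`. -/
def incl (h : c.HHat y) (i : Fin r) : M i →ₗ[k] HatTensor y c M where
  toFun m := h ⊗ₜ[Fin r → k] Pi.single i m
  map_add' m m' := by rw [Pi.single_add, TensorProduct.tmul_add]
  map_smul' a m := by
    have h1 : (Pi.single i (a • m) : ∀ i, M i) =
        (fun _ => a : Fin r → k) • (Pi.single i m : ∀ i, M i) := by
      rw [Pi.single_smul]; rfl
    rw [h1, ← TensorProduct.smul_tmul, c.const_smul_HHat, TensorProduct.smul_tmul',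
      RingHom.id_apply]

theorem incl_apply (h : c.HHat y) (i : Fin r) (m : M i) :
    incl y c M h i m = h ⊗ₜ[Fin r → k] Pi.single i m := rfl

theorem smul_incl (g h : c.HHat y) (i : Fin r) (m : M i) :
    g • incl y c M h i m = incl y c M (g * h) i m := rfl

theorem incl_add (g h : c.HHat y) (i : Fin r) (m : M i) :
    incl y c M (g + h) i m = incl y c M g i m + incl y c M h i m :=
  TensorProduct.add_tmul _ _ _

theorem incl_sum {κ : Type*} (s : Finset κ) (h : κ → c.HHat y) (i : Fin r) (m : M i) :
    incl y c M (∑ g ∈ s, h g) i m = ∑ g ∈ s, incl y c M (h g) i m :=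
  TensorProduct.sum_tmul _ _ _

theorem incl_smul (a : k) (h : c.HHat y) (i : Fin r) (m : M i) :
    incl y c M (a • h) i m = a • incl y c M h i m := rfl

/-- The idempotent e_i acts through k^r, crosses the tensor sign and is the identity on the summand
M_i. -/
theorem incl_idempotent (i : Fin r) (m : M i) :
    incl y c M (c.toHHat y (MatPoly.mono (Monomial.one i))) i m = incl y c M 1 i m := by
  have h : c.toHHat y (MatPoly.mono (Monomial.one i)) =
      (Pi.single i 1 : Fin r → k) • (1 : c.HHat y) := by
    rw [c.smul_HHat_def, one_mul, MatPoly.diagHom_eq_sum, Finset.sum_eq_single i,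
      Pi.single_eq_same, one_smul]
    · intro j _ hj
      rw [Pi.single_eq_of_ne hj, zero_smul]
    · simp
  rw [incl_apply, incl_apply, h, TensorProduct.smul_tmul]
  congr 1
  funext j
  rw [Pi.smul_apply']
  by_cases hj : j = i
  · subst hj; simp
  · rw [Pi.single_eq_of_ne hj, Pi.single_eq_of_ne hj, smul_zero]

theorem reduce_incl (h : c.HHat y) (i : Fin r) (m : M i) :
    reduce y c M (incl y c M h i m) = c.augHat y h • (Pi.single i m : ∀ i, M i) := rfl

theorem reduce_incl_one (i : Fin r) (m : M i) :
    reduce y c M (incl y c M 1 i m) = Pi.single i m := by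
  have h : c.augHat y 1 = 1 := by
    change c.augBar y (c.proj y 0 1) = 1
    rw [map_one, map_one]
  rw [reduce_incl, h, one_smul]

theorem addHom_ext {P : Type*} [AddCommMonoid P] {F G : HatTensor y c M →+ P}
    (h : ∀ g i m, F (incl y c M g i m) = G (incl y c M g i m)) : F = G := by
  ext z
  induction z using TensorProduct.induction_on with
  | zero => rw [map_zero, map_zero]
  | add z z' hz hz' => rw [map_add, map_add, hz, hz']
  | tmul g m =>
  rw [← Finset.univ_sum_single m, TensorProduct.tmul_sum, map_sum, map_sum]
  exact Finset.sum_congr rfl fun i _ => h g i (m i)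

/-- The `Ĥ`-linear endomorphism of `Ĥ ⊗_{k^r} (⊕ M_i)` determined by its restrictions
`φ_i : M_i → e_i (Ĥ ⊗_{k^r} (⊕ M_j))`. -/
def extend (φ : ∀ i, M i →ₗ[k] HatTensor y c M)
    (hφ : ∀ i m, c.toHHat y (MatPoly.mono (Monomial.one i)) • φ i m = φ i m) :
    Module.End k (HatTensor y c M) :=
  let F : HatTensor y c M →+ HatTensor y c M := TensorProduct.liftAddHom
    { toFun := fun h =>
        { toFun := fun m => ∑ i, h • φ i (m i)
          map_zero' := by simp
          map_add' := fun m m' => by simp [Finset.sum_add_distrib] }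
      map_zero' := by ext m; simp
      map_add' := fun h h' => by ext m; simp [add_smul, Finset.sum_add_distrib] }
    fun a h m => by
      change ∑ i, (a • h) • φ i (m i) = ∑ i, h • φ i (a i • m i)
      refine Finset.sum_congr rfl fun i _ => ?_
      -- Since φ_i takes values in the part fixed by e_i, the diagonal matrix of `a` acts there as
      -- the scalar `a i`; this is the balancing over k^r.
      rw [c.smul_HHat_def, mul_smul, map_smul, ← hφ i (m i), smul_smul (c.toHHat y _), ← map_mul,
        MatPoly.diagHom_mul_mono, map_smul, smul_assoc]
  { F with
    map_smul' := fun a z => by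
      change F (a • z) = a • F z
      refine DFunLike.congr_fun (addHom_ext (F := F.comp (DistribSMul.toAddMonoidHom _ a))
        (G := (DistribSMul.toAddMonoidHom _ a).comp F) fun g i m => ?_) z
      change ∑ j, (a • g) • φ j _ = a • ∑ j, g • φ j _
      simp only [smul_assoc, Finset.smul_sum] }

variable {φ : ∀ i, M i →ₗ[k] HatTensor y c M}
  (hφ : ∀ i m, c.toHHat y (MatPoly.mono (Monomial.one i)) • φ i m = φ i m)

theorem extend_incl (h : c.HHat y) (i : Fin r) (m : M i) :
    extend φ hφ (incl y c M h i m) = h • φ i m := by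
  change ∑ j, h • φ j ((Pi.single i m : ∀ i, M i) j) = _
  rw [Finset.sum_eq_single i, Pi.single_eq_same]
  · intro j _ hj
    rw [Pi.single_eq_of_ne hj, map_zero, smul_zero]
  · simp

theorem extend_smul (h : c.HHat y) (z : HatTensor y c M) :
    extend φ hφ (h • z) = h • extend φ hφ z := by
  refine DFunLike.congr_fun (addHom_ext
    (F := (extend φ hφ).toAddMonoidHom.comp (DistribSMul.toAddMonoidHom _ h))
    (G := (DistribSMul.toAddMonoidHom _ h).comp (extend φ hφ).toAddMonoidHom) fun g i m => ?_) z
  change extend φ hφ (h • incl y c M g i m) = h • extend φ hφ (incl y c M g i m)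
  rw [smul_incl, extend_incl, extend_incl, mul_smul]

end HatTensor

open HatTensor

/-- A multiplicative family of maps `φ_a : M_i → e_i (Ĥ ⊗_{k^r} (⊕ M_j))` determines a homomorphism
to `Â_M`. -/
def Completion.algHom {A : Type*} [Ring A] [Algebra k A]
    (φ : A →ₗ[k] ∀ i, M i →ₗ[k] HatTensor y c M)
    (hφ : ∀ a i m, c.toHHat y (MatPoly.mono (Monomial.one i)) • φ a i m = φ a i m)
    (h1 : ∀ i m, φ 1 i m = incl y c M 1 i m)
    (hmul : ∀ a b i m, extend (φ b) (hφ b) (φ a i m) = φ (a * b) i m) :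
    A →ₐ[k] Completion y c M :=
  have hext : ∀ {F G : Module.End k (HatTensor y c M)},
      (∀ g i m, F (incl y c M g i m) = G (incl y c M g i m)) → F = G := fun {F G} h =>
    LinearMap.toAddMonoidHom_injective (addHom_ext h)
  AlgHom.ofLinearMap
    { toFun := fun a => MulOpposite.op (extend (φ a) (hφ a))
      map_add' := fun a b => MulOpposite.unop_injective <| hext fun g i m => by
        change extend (φ (a + b)) (hφ _) _ = extend (φ a) (hφ a) _ + extend (φ b) (hφ b) _
        simp only [extend_incl, map_add, Pi.add_apply, LinearMap.add_apply, smul_add]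
      map_smul' := fun e a => MulOpposite.unop_injective <| hext fun g i m => by
        change extend (φ (e • a)) (hφ _) _ = e • extend (φ a) (hφ a) _
        simp only [extend_incl, map_smul, Pi.smul_apply, LinearMap.smul_apply]
        exact smul_comm g e _ }
    (MulOpposite.unop_injective <| hext fun g i m => by
      change extend (φ 1) (hφ 1) _ = incl y c M g i m
      rw [extend_incl, h1, smul_incl, mul_one])
    fun a b => MulOpposite.unop_injective <| hext fun g i m => by
      change extend (φ (a * b)) (hφ _) _ = extend (φ b) (hφ b) (extend (φ a) (hφ a) _)
      rw [extend_incl, extend_incl, extend_smul, hmul]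

theorem Completion.algHom_unop_incl_one {A : Type*} [Ring A] [Algebra k A]
    (φ : A →ₗ[k] ∀ i, M i →ₗ[k] HatTensor y c M)
    (hφ : ∀ a i m, c.toHHat y (MatPoly.mono (Monomial.one i)) • φ a i m = φ a i m)
    (h1 : ∀ i m, φ 1 i m = incl y c M 1 i m)
    (hmul : ∀ a b i m, extend (φ b) (hφ b) (φ a i m) = φ (a * b) i m) (a : A) (i : Fin r)
    (m : M i) : (algHom φ hφ h1 hmul a).unop (1 ⊗ₜ[Fin r → k] Pi.single i m) = φ a i m :=
  (extend_incl (hφ a) 1 i m).trans (one_smul _ _)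

theorem Completion.algHom_unop_smul {A : Type*} [Ring A] [Algebra k A]
    (φ : A →ₗ[k] ∀ i, M i →ₗ[k] HatTensor y c M)
    (hφ : ∀ a i m, c.toHHat y (MatPoly.mono (Monomial.one i)) • φ a i m = φ a i m)
    (h1 : ∀ i m, φ 1 i m = incl y c M 1 i m)
    (hmul : ∀ a b i m, extend (φ b) (hφ b) (φ a i m) = φ (a * b) i m) (a : A) (h : c.HHat y)
    (z : HatTensor y c M) :
    (algHom φ hφ h1 hmul a).unop (h • z) = h • (algHom φ hφ h1 hmul a).unop z :=
  extend_smul (hφ a) h z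

end HatTensor

/-! ### Formal sums with coefficients in finite dimensional modules -/

section FormalSum

open HatTensor

variable {k : Type u} [Field k] {r : ℕ} {L : GMMPAlgebra.{u, v, w} k r}
  {l : Fin r → Fin r → ℕ} {I : Fin r → Fin r → Type*}
  (y : ∀ i j, Module.Basis (I i j) k (L.W i j ⧸ LinearMap.range (L.d i j)))
  (c : Choices L l)
  {M : Fin r → Type*} [∀ i, AddCommGroup (M i)] [∀ i, Module k (M i)]
  {κ : Fin r → Type*} [∀ j, Fintype (κ j)] (b : ∀ j, Module.Basis (κ j) k (M j))

/-- The element `∑ u ⊗ ξ_u` of `Ĥ ⊗_{k^r} (⊕ M_j)`, summed over all chosen words `u` of type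
`(i, j)` and of positive degree, for a finite dimensional `M_j`. -/
def formalSum (i j : Fin r) : (Monomial l i j → M j) →ₗ[k] HatTensor y c M where
  toFun ξ := ∑ g, incl y c M (c.series y i j fun u => (b j).coord g (ξ u)) j (b j g)
  map_add' ξ η := by
    rw [← Finset.sum_add_distrib]
    refine Finset.sum_congr rfl fun g _ => ?_
    rw [← incl_add, ← map_add]
    congr 3
    funext u
    exact map_add _ _ _
  map_smul' a ξ := by
    rw [Finset.smul_sum]
    refine Finset.sum_congr rfl fun g _ => ?_
    rw [RingHom.id_apply, ← incl_smul, ← map_smul]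
    congr 3
    funext u
    exact map_smul _ _ _

theorem formalSum_apply {i j : Fin r} (ξ : Monomial l i j → M j) :
    formalSum y c b i j ξ =
      ∑ g, incl y c M (c.series y i j fun u => (b j).coord g (ξ u)) j (b j g) := rfl

theorem one_smul_formalSum {i j : Fin r} (ξ : Monomial l i j → M j) :
    c.toHHat y (MatPoly.mono (Monomial.one i)) • formalSum y c b i j ξ =
      formalSum y c b i j ξ := by
  rw [formalSum_apply, Finset.smul_sum]
  exact Finset.sum_congr rfl fun g _ => by rw [smul_incl, c.toHHat_one_mul_series]

theorem formalSum_eq_zero {i j : Fin r} {ξ : Monomial l i j → M j}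
    (hξ : ∀ u, 1 ≤ u.degree → u ∈ c.B u.degree i j → ξ u = 0) : formalSum y c b i j ξ = 0 := by
  rw [formalSum_apply]
  refine Finset.sum_eq_zero fun g _ => ?_
  rw [c.series_eq_zero y fun u h h' => by rw [hξ u h h', map_zero]]
  exact TensorProduct.zero_tmul _ _

/-- A linear map applied to the basis vectors can be moved to the coefficients: both sides have the
same coordinates once the images of the basis vectors are expanded. -/
theorem sum_incl_series_map {i j : Fin r} (ξ : Monomial l i j → M j) (f : M j →ₗ[k] M j) :
    ∑ g, incl y c M (c.series y i j fun u => (b j).coord g (ξ u)) j (f (b j g)) =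
      formalSum y c b i j fun u => f (ξ u) := by
  have h : ∀ g, incl y c M (c.series y i j fun u => (b j).coord g (ξ u)) j (f (b j g)) =
      ∑ g', incl y c M ((b j).coord g' (f (b j g)) •
        c.series y i j fun u => (b j).coord g (ξ u)) j (b j g') := fun g => by
    conv_lhs => rw [← (b j).sum_repr (f (b j g)), map_sum]
    exact Finset.sum_congr rfl fun g' _ => by rw [map_smul, incl_smul]; rfl
  rw [Finset.sum_congr rfl fun g _ => h g, Finset.sum_comm, formalSum_apply]
  refine Finset.sum_congr rfl fun g' _ => ?_
  rw [← incl_sum]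
  simp only [← map_smul]
  rw [← map_sum]
  congr 3
  funext u
  rw [Finset.sum_apply]
  conv_rhs => rw [← (b j).sum_repr (ξ u), map_sum, map_sum]
  refine Finset.sum_congr rfl fun g _ => ?_
  rw [map_smul, map_smul, Pi.smul_apply, smul_eq_mul, smul_eq_mul, mul_comm]
  rfl

theorem reduce_formalSum {i j : Fin r} (ξ : Monomial l i j → M j) :
    reduce y c M (formalSum y c b i j ξ) = 0 := by
  rw [formalSum_apply, map_sum]
  exact Finset.sum_eq_zero fun g _ => by rw [reduce_incl, c.augHat_series, zero_smul]

theorem smul_tmul_single (N : ℕ) (a : k) (h : c.HBar y N) (j : Fin r) (m : M j) :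
    (a • h) ⊗ₜ[Fin r → k] (Pi.single j m : ∀ j, M j) = h ⊗ₜ[Fin r → k] Pi.single j (a • m) := by
  rw [← c.const_smul_HBar, TensorProduct.smul_tmul, Pi.single_smul]
  rfl

theorem reduceBar_formalSum (N : ℕ) {i j : Fin r} (ξ : Monomial l i j → M j) :
    reduceBar y c M N (formalSum y c b i j ξ) = ∑ u ∈ c.words (N + 1) i j,
      c.quot y N (MatPoly.mono u) ⊗ₜ[Fin r → k] (Pi.single j (ξ u) : ∀ j, M j) := by
  have h : ∀ g, reduceBar y c M N
      (incl y c M (c.series y i j fun u => (b j).coord g (ξ u)) j (b j g)) =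
        ∑ u ∈ c.words (N + 1) i j, c.quot y N (MatPoly.mono u) ⊗ₜ[Fin r → k]
          (Pi.single j ((b j).repr (ξ u) g • b j g) : ∀ j, M j) := fun g => by
    change c.proj y N _ ⊗ₜ[Fin r → k] _ = _
    rw [c.proj_series, TensorProduct.sum_tmul]
    exact Finset.sum_congr rfl fun u _ => smul_tmul_single y c N _ _ _ _
  rw [formalSum_apply, map_sum, Finset.sum_congr rfl fun g _ => h g, Finset.sum_comm]
  refine Finset.sum_congr rfl fun u _ => ?_
  rw [← TensorProduct.tmul_sum]
  congr 1
  conv_rhs => rw [← (b j).sum_repr (ξ u)]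
  exact (map_sum (AddMonoidHom.single (fun j => M j) j) _ _).symm

end FormalSum

/-! ### The versal and the constant family -/

section Versal

open HatTensor

variable {k : Type u} [Field k] {A : Type v} [Ring A] [Algebra k A] {r : ℕ}
  {M : Fin r → Type w} [∀ i, AddCommGroup (M i)] [∀ i, Module k (M i)]
  [∀ i, Module Aᵐᵒᵖ (M i)] [∀ i, IsScalarTower k Aᵐᵒᵖ (M i)]
  {l : Fin r → Fin r → ℕ} {x : ∀ i j, Fin (l i j) → Z1 k A M i j}
  {I : Fin r → Fin r → Type*}
  {y : ∀ i j, Module.Basis (I i j) k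
    ((hochschildGMMP k A M).W i j ⧸ LinearMap.range ((hochschildGMMP k A M).d i j))}
  (H : Computation (L := hochschildGMMP k A M) (fun i j p => (x i j p).1) y)
  {κ : Fin r → Type*} [∀ j, Fintype (κ j)] (b : ∀ j, Module.Basis (κ j) k (M j))

namespace Computation

/-- The cochain `v_u`. -/
def cochain {i j : Fin r} (u : Monomial l i j) : C1 k A M i j := H.v u

/-- Needed for unitality. By induction on the degree, every cup product in the equation for `d v_u`
vanishes at `(1, 1)`. -/
theorem cochain_apply_one {i j : Fin r} (u : Monomial l i j) (hu : 1 ≤ u.degree)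
    (hu' : u ∈ H.B u.degree i j) : H.cochain u 1 = 0 := by
  induction hn : u.degree using Nat.strong_induction_on generalizing i j with
  | _ n ih =>
  have h : d1 k A M i j (H.cochain u) = -∑ p ∈ H.pairs u.degree i j,
      H.β u.degree (p.2.1.mul p.2.2) u •
        cup k A M i p.1 j (H.cochain p.2.1) (H.cochain p.2.2) :=
      H.d_v_eq (fun i j p => (x i j p).2) hu hu'
  ext z
  -- At `(1, 1)` two of the three terms of the differential cancel and `v_u(1)` is left.
  have h1 := congrArg (fun f : C2 k A M i j => f 1 1 z) h
  simp only [d1_apply, MulOpposite.op_one, one_smul, mul_one, sub_self, zero_add] at h1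
  rw [h1, LinearMap.neg_apply, LinearMap.neg_apply, LinearMap.neg_apply, LinearMap.sum_apply,
    LinearMap.sum_apply, LinearMap.sum_apply, Finset.sum_eq_zero, neg_zero, LinearMap.zero_apply]
  intro p hp
  rw [Choices.mem_pairs, Choices.mem_words, Choices.mem_words] at hp
  rw [LinearMap.smul_apply, LinearMap.smul_apply, LinearMap.smul_apply, cup_apply,
    ih _ (by omega) p.2.1 hp.1.1 hp.1.2.2 rfl, LinearMap.zero_apply, map_zero, smul_zero]

/-- The action `m ↦ 1 ⊗ m a + ∑ u ⊗ v_u(a)(m)` of `a` on the versal family. -/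
def versal : A →ₗ[k] ∀ i, M i →ₗ[k] HatTensor y H.toChoices M :=
  LinearMap.pi fun i => LinearMap.mk₂ k
    (fun a m => incl y H.toChoices M 1 i (act k A M i a m) +
      ∑ j, formalSum y H.toChoices b i j fun u => H.cochain u a m)
    (fun a a' m => by
      rw [map_add, LinearMap.add_apply, map_add, add_add_add_comm, ← Finset.sum_add_distrib]
      congr 1
      refine Finset.sum_congr rfl fun j _ => ?_
      rw [← map_add]
      congr 1
      funext u
      rw [map_add, LinearMap.add_apply, Pi.add_apply])
    (fun e a m => by
      rw [map_smul, LinearMap.smul_apply, map_smul, smul_add, Finset.smul_sum]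
      congr 1
      refine Finset.sum_congr rfl fun j _ => ?_
      rw [← map_smul]
      congr 1
      funext u
      rw [map_smul, LinearMap.smul_apply, Pi.smul_apply])
    (fun a m m' => by
      rw [map_add, map_add, add_add_add_comm, ← Finset.sum_add_distrib]
      congr 1
      refine Finset.sum_congr rfl fun j _ => ?_
      rw [← map_add]
      congr 1
      funext u
      rw [map_add, Pi.add_apply])
    (fun e a m => by
      rw [map_smul, map_smul, smul_add, Finset.smul_sum]
      congr 1
      refine Finset.sum_congr rfl fun j _ => ?_
      rw [← map_smul]
      congr 1
      funext u
      rw [map_smul, Pi.smul_apply])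

theorem versal_apply (a : A) (i : Fin r) (m : M i) :
    H.versal b a i m = incl y H.toChoices M 1 i (MulOpposite.op a • m) +
      ∑ j, formalSum y H.toChoices b i j fun u => H.cochain u a m := rfl

theorem one_smul_versal (a : A) (i : Fin r) (m : M i) :
    H.toHHat y (MatPoly.mono (Monomial.one i)) • H.versal b a i m = H.versal b a i m := by
  rw [versal_apply, smul_add, smul_incl, mul_one, incl_idempotent, Finset.smul_sum]
  congr 1
  exact Finset.sum_congr rfl fun j _ => one_smul_formalSum y H.toChoices b _

theorem versal_one (i : Fin r) (m : M i) :
    H.versal b 1 i m = incl y H.toChoices M 1 i m := by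
  rw [versal_apply, MulOpposite.op_one, one_smul, Finset.sum_eq_zero, add_zero]
  intro j _
  refine formalSum_eq_zero y H.toChoices b fun u hu hu' => ?_
  rw [H.cochain_apply_one u hu hu', LinearMap.zero_apply]

/-- This is the Maurer-Cartan equation evaluated at `(a, a')` and `m`, read off in each coordinate
of the target; the inner sum over the basis of M_j computes the composite in the cup product. -/
theorem sum_sum_formalSum_cochain (a a' : A) (i : Fin r) (m : M i) :
    ∑ j, ∑ g, H.series y i j (fun u => (b j).coord g (H.cochain u a m)) •
        ∑ n, formalSum y H.toChoices b j n (fun u => H.cochain u a' (b j g)) =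
      -∑ n, formalSum y H.toChoices b i n fun u => d1 k A M i n (H.cochain u) a a' m := by
  have key : ∀ n g', ∑ j, ∑ g, H.series y i j (fun u => (b j).coord g (H.cochain u a m)) *
      H.series y j n (fun u => (b n).coord g' (H.cochain u a' (b j g))) =
        -H.series y i n fun u => (b n).coord g' (d1 k A M i n (H.cochain u) a a' m) := by
    intro n g'
    let e : C2 k A M i n →ₗ[k] k :=
      (b n).coord g' ∘ₗ LinearMap.applyₗ m ∘ₗ LinearMap.applyₗ a' ∘ₗ LinearMap.applyₗ a
    refine H.maurerCartan (fun i j p => (x i j p).2) e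
      (fun j g u => (b j).coord g (H.cochain u a m))
      (fun j g u => (b n).coord g' (H.cochain u a' (b j g))) fun j s t => ?_
    change _ = (b n).coord g' (H.cochain t a' (H.cochain s a m))
    conv_rhs => rw [← (b j).sum_repr (H.cochain s a m), map_sum, map_sum]
    refine Finset.sum_congr rfl fun g _ => ?_
    rw [map_smul, map_smul, smul_eq_mul]
    rfl
  rw [← Finset.sum_neg_distrib]
  simp only [Finset.smul_sum, formalSum_apply, smul_incl]
  rw [Finset.sum_congr rfl fun j _ => Finset.sum_comm, Finset.sum_comm]
  refine Finset.sum_congr rfl fun n _ => ?_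
  rw [Finset.sum_congr rfl fun j _ => Finset.sum_comm, Finset.sum_comm, ← Finset.sum_neg_distrib]
  refine Finset.sum_congr rfl fun g' _ => ?_
  simp only [← incl_sum]
  rw [key]
  exact TensorProduct.neg_tmul _ _

/-- Composing the two actions gives the terms v_u(a')(ma) and v_u(a)(m)a' and a double sum. By
Maurer-Cartan the double sum is -∑ u ⊗ (d v_u)(a, a')(m), which cancels these terms and leaves
v_u(aa')(m). -/
theorem extend_versal (a a' : A) (i : Fin r) (m : M i) :
    extend (H.versal b a') (H.one_smul_versal b a') (H.versal b a i m) =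
      H.versal b (a * a') i m := by
  have h1 : ∀ j, extend (H.versal b a') (H.one_smul_versal b a')
      (formalSum y H.toChoices b i j fun u => H.cochain u a m) =
        formalSum y H.toChoices b i j (fun u => MulOpposite.op a' • H.cochain u a m) +
          ∑ g, H.series y i j (fun u => (b j).coord g (H.cochain u a m)) •
            ∑ n, formalSum y H.toChoices b j n (fun u => H.cochain u a' (b j g)) := fun j => by
    rw [formalSum_apply, map_sum]
    simp only [extend_incl, versal_apply, smul_add, smul_incl, mul_one, Finset.sum_add_distrib]
    congr 1
    exact sum_incl_series_map y H.toChoices b (fun u => H.cochain u a m) (act k A M j a')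
  rw [versal_apply H b a, map_add, extend_incl, one_smul, map_sum,
    Finset.sum_congr rfl fun j _ => h1 j, Finset.sum_add_distrib, sum_sum_formalSum_cochain,
    versal_apply, versal_apply, MulOpposite.op_mul, mul_smul, add_assoc, ← sub_eq_add_neg,
    ← Finset.sum_sub_distrib, ← Finset.sum_add_distrib]
  congr 1
  refine Finset.sum_congr rfl fun j _ => ?_
  rw [← map_sub, ← map_add]
  congr 1
  funext u
  simp only [Pi.add_apply, Pi.sub_apply, d1_apply]
  abel

theorem reduceBar_versal (a : A) (i : Fin r) (m : M i) :
    reduceBar y H.toChoices M 1 (H.versal b a i m) =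
      1 ⊗ₜ[Fin r → k] Pi.single i (MulOpposite.op a • m) +
        ∑ j : Fin r, ∑ p : Fin (l i j), H.quot y 1 (MatPoly.mono (Monomial.var p)) ⊗ₜ[Fin r → k]
          (Pi.single j ((x i j p).1 a m) : ∀ j, M j) := by
  classical
  rw [versal_apply, map_add, map_sum]
  congr 1
  refine Finset.sum_congr rfl fun j _ => ?_
  rw [reduceBar_formalSum, H.words_two_eq_image_var,
    Finset.sum_image fun _ _ _ _ h => Monomial.var_injective h]
  refine Finset.sum_congr rfl fun p _ => ?_
  have h : H.cochain (Monomial.var p) = (x i j p).1 := H.v_var i j p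
  rw [h]

/-- The action `m ↦ 1 ⊗ m a` of `a` on the constant family. -/
def constant : A →ₗ[k] ∀ i, M i →ₗ[k] HatTensor y H.toChoices M :=
  LinearMap.pi fun i => (incl y H.toChoices M 1 i).compRight k ∘ₗ act k A M i

theorem constant_apply (a : A) (i : Fin r) (m : M i) :
    H.constant a i m = incl y H.toChoices M 1 i (MulOpposite.op a • m) := rfl

theorem one_smul_constant (a : A) (i : Fin r) (m : M i) :
    H.toHHat y (MatPoly.mono (Monomial.one i)) • H.constant a i m = H.constant a i m := by
  rw [constant_apply, smul_incl, mul_one, incl_idempotent]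

theorem constant_one (i : Fin r) (m : M i) :
    H.constant 1 i m = incl y H.toChoices M 1 i m := by
  rw [constant_apply, MulOpposite.op_one, one_smul]

theorem extend_constant (a a' : A) (i : Fin r) (m : M i) :
    extend (H.constant a') (H.one_smul_constant a') (H.constant a i m) =
      H.constant (a * a') i m := by
  rw [constant_apply, extend_incl, one_smul, constant_apply, constant_apply, MulOpposite.op_mul,
    mul_smul]

end Computation

theorem diagonal_algHom {c : Choices (hochschildGMMP k A M) l}
    (φ : A →ₗ[k] ∀ i, M i →ₗ[k] HatTensor y c M)
    (hφ : ∀ a i m, c.toHHat y (MatPoly.mono (Monomial.one i)) • φ a i m = φ a i m)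
    (h1 : ∀ i m, φ 1 i m = incl y c M 1 i m)
    (hmul : ∀ a b i m, extend (φ b) (hφ b) (φ a i m) = φ (a * b) i m)
    (hred : ∀ a i m, reduce y c M (φ a i m) = Pi.single i (MulOpposite.op a • m))
    (a : A) (i : Fin r) :
    diagonal y c M (Completion.algHom φ hφ h1 hmul a) i = rho k A M i a := by
  refine MulOpposite.unop_injective (LinearMap.ext fun m => ?_)
  rw [rho_apply]
  change reduce y c M ((Completion.algHom φ hφ h1 hmul a).unop
    (1 ⊗ₜ[Fin r → k] Pi.single i m)) i = _
  rw [Completion.algHom_unop_incl_one, hred, Pi.single_eq_same]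

end Versal

end GMMP

end

theorem mainTheorem2 {k : Type*} [Field k] {A : Type*} [Ring A] [Algebra k A] {r : ℕ}
    (M : Fin r → Type*) [∀ i, AddCommGroup (M i)] [∀ i, Module k (M i)]
    [∀ i, Module Aᵐᵒᵖ (M i)] [∀ i, IsScalarTower k Aᵐᵒᵖ (M i)]
    [∀ i, IsSimpleModule Aᵐᵒᵖ (M i)]
    (l : Fin r → Fin r → ℕ)
    (x : ∀ i j, Fin (l i j) → GMMP.Z1 k A M i j)
    (x_indep : ∀ i j, LinearIndependent k fun p => GMMP.extClass k A M i j (x i j p))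
    (x_span : ∀ i j, Submodule.span k (Set.range fun p => GMMP.extClass k A M i j (x i j p)) = ⊤)
    {I : Fin r → Fin r → Type*}
    (y : ∀ i j, Module.Basis (I i j) k
      ((GMMP.hochschildGMMP k A M).W i j ⧸ LinearMap.range ((GMMP.hochschildGMMP k A M).d i j))) :
    Nonempty (GMMP.Computation (L := GMMP.hochschildGMMP k A M) (fun i j p => (x i j p).1) y) ∧
    ∀ H : GMMP.Computation (L := GMMP.hochschildGMMP k A M) (fun i j p => (x i j p).1) y,
      ∃ ι : A →ₐ[k] GMMP.Completion y H.toChoices M,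
        (∀ (a : A) (i : Fin r),
          GMMP.diagonal y H.toChoices M (ι a) i = GMMP.rho k A M i a) ∧
        (∀ (a : A) (h : H.HHat y) (z : GMMP.HatTensor y H.toChoices M),
          (ι a).unop (h • z) = h • (ι a).unop z) ∧
        ((∀ i, FiniteDimensional k (M i)) → ∀ (a : A) (i : Fin r) (m : M i),
          GMMP.reduceBar y H.toChoices M 1 ((ι a).unop (1 ⊗ₜ[Fin r → k] Pi.single i m)) =
            1 ⊗ₜ[Fin r → k] Pi.single i (MulOpposite.op a • m) +
            ∑ j : Fin r, ∑ p : Fin (l i j),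
              H.quot y 1 (GMMP.MatPoly.mono (GMMP.Monomial.var p)) ⊗ₜ[Fin r → k]
                Pi.single j ((x i j p).1 a m)) := by
  refine ⟨GMMP.Computation.nonempty _ y, fun H => ?_⟩
  -- The versal family is needed only for the last condition, which is conditional on finite
  -- dimensionality.
  by_cases hM : ∀ i, FiniteDimensional k (M i)
  · let b : ∀ i, Module.Basis (Fin (Module.finrank k (M i))) k (M i) :=
      fun i => Module.finBasis k (M i)
    refine ⟨GMMP.Completion.algHom (H.versal b) (H.one_smul_versal b) (H.versal_one b)
      (H.extend_versal b), ?_, GMMP.Completion.algHom_unop_smul _ _ _ _, fun _ a i m => ?_⟩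
    · refine GMMP.diagonal_algHom _ _ _ _ fun a i m => ?_
      rw [H.versal_apply, map_add, GMMP.HatTensor.reduce_incl_one, map_sum, Finset.sum_eq_zero,
        add_zero]
      exact fun j _ => GMMP.reduce_formalSum y H.toChoices b _
    · rw [GMMP.Completion.algHom_unop_incl_one, H.reduceBar_versal]
  -- `∑ u ⊗ v_u(a)(m)` need not converge if some `M_i` is infinite dimensional.
  · refine ⟨GMMP.Completion.algHom H.constant H.one_smul_constant H.constant_one
      H.extend_constant, ?_, GMMP.Completion.algHom_unop_smul _ _ _ _, fun h => absurd h hM⟩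
    exact GMMP.diagonal_algHom _ _ _ _ fun a i m => GMMP.HatTensor.reduce_incl_one _ _
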